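/- Let $D\subset\mathbb{R}^2$ be a bounded domain (open and connected) whose boundary $\Gamma$ is a smooth ($C^\infty$) simple closed curve. Let $ds$ be arc length on $\Gamma$, $\nu$ the unit outward normal and $\tau=(-\nu_2,\nu_1)$ the (counterclockwise) unit tangent, and let $T>0$. Let $$G_L(x,y)=-\frac1{2\pi}\ln|x-y|,\qquad G_H(x,t)=\frac1{4\pi t}e^{-|x|^2/(4t)}\quad(t>0).$$ For $x\in\Gamma$, $t\in[0,T]$, $\eta\in\{\nu,\tau\}$, and densities $\rho$ on $\Gamma$, $\mu$ on $\Gamma\times[0,T]$, put $$S_{L\eta}[\rho](x)=\mathrm{p.v.}\!\int_\Gamma\frac{\partial G_L(x,y)}{\partial\eta(x)}\rho(y)\,ds(y),\qquad S_{H\eta}[\mu](x,t)=\mathrm{p.v.}\!\int_0^t\!\int_\Gamma\frac{\partial G_H(x-y,t-t')}{\partial\eta(x)}\mu(y,t')\,ds(y)\,dt',$$ where the principal value is the limit as $\varepsilon\to0+$ of the integrals over the $y\in\Gamma$ with $|x-y|>\varepsilon$; for a density $\rho$ on $\Gamma\times[0,T]$, let $S_{L\eta}[\rho](x,t)=S_{L\eta}[\rho(\cdot,t)](x)$.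 The nullspace in $L^2(\Gamma)$ of the operator $\frac12 I+S_{L\nu}$ is one-dimensional. If $\rho_0$ spans it and $f$ is any real-valued $C^\infty$ function on $[0,T]$, then the pair $(\rho,\mu)$ with $\rho(x,t)=\rho_0(x)f(t)$ and $\mu=0$ belongs to the nullspace of the two-dimensional combined source integral equation system: $\rho,\mu\in L^2(\Gamma\times[0,T])$, and for almost every $(x,t)\in\Gamma\times[0,T]$ all four principal values below exist and $$\tfrac12\rho(x,t)+S_{L\nu}[\rho](x,t)+S_{H\tau}[\mu](x,t)=0,\qquad \tfrac12\mu(x,t)+S_{H\nu}[\mu](x,t)-S_{L\tau}[\rho](x,t)=0.$$ -/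

import Mathlib

open MeasureTheory Set Filter Topology
open scoped ContDiff

/-- The Euclidean plane. -/
abbrev Plane : Type := EuclideanSpace ℝ (Fin 2)

/-- Rotation by `-π/2`; it turns the counterclockwise unit tangent into the outward normal. -/
def rotCW (v : Plane) : Plane := !₂[v 1, -v 0]

/-- Green's function of the Laplace equation in the plane, `-(1/2π) ln |x - y|`. -/
noncomputable def greenLaplace (x y : Plane) : ℝ :=
  -(1 / (2 * Real.pi)) * Real.log ‖x - y‖

/-- Green's function of the heat equation in the plane, `(4πt)⁻¹ exp (-|x|²/(4t))` (for `t > 0`). -/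
noncomputable def greenHeat (x : Plane) (t : ℝ) : ℝ :=
  1 / (4 * Real.pi * t) * Real.exp (-‖x‖ ^ 2 / (4 * t))

/-- A bounded planar domain `D` whose boundary is a smooth simple closed curve `Γ`.
The curve is given by a counterclockwise parametrization `γ` by arc length. -/
structure SmoothJordanDomain where
  /-- the domain -/
  D : Set Plane
  /-- the length of the boundary curve -/
  L : ℝ
  /-- the arc length parametrization of the boundary curve -/
  γ : ℝ → Plane
  isOpen_D : IsOpen D
  isConnected_D : IsConnected D
  isBounded_D : Bornology.IsBounded D
  L_pos : 0 < L
  contDiff_γ : ContDiff ℝ ∞ γ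
  periodic_γ : Function.Periodic γ L
  injOn_γ : InjOn γ (Ico 0 L)
  norm_deriv_γ : ∀ s, ‖deriv γ s‖ = 1
  frontier_D : frontier D = range γ
  /-- Just behind `γ s`, seen along the normal `rotCW (γ' s)`, lies the domain. -/
  inner_side : ∀ s, ∀ᶠ ε : ℝ in 𝓝[>] 0, γ s - ε • rotCW (deriv γ s) ∈ D
  /-- Just ahead of `γ s`, along the normal `rotCW (γ' s)`, lies the exterior. -/
  outer_side : ∀ s, ∀ᶠ ε : ℝ in 𝓝[>] 0, γ s + ε • rotCW (deriv γ s) ∉ closure D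

namespace SmoothJordanDomain

variable (Ω : SmoothJordanDomain)

/-- The arc length measure `ds` on the boundary curve `Γ`, as a measure on the plane. -/
noncomputable def arcLength : Measure Plane :=
  (volume.restrict (Ico 0 Ω.L)).map Ω.γ

/-- The unit tangent vector at a point `x` of `Γ` (counterclockwise direction). -/
noncomputable def tangent (x : Plane) : Plane :=
  deriv Ω.γ (Function.invFunOn Ω.γ (Ico 0 Ω.L) x)

/-- The unit outward normal vector at a point `x` of `Γ`. -/
noncomputable def normal (x : Plane) : Plane := rotCW (Ω.tangent x)

/-- `Ω.HasDerivSL v ρ x a`: for `x ∈ Γ`, the principal value integral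
`p.v. ∫_Γ ∂G_L(x, y)/∂v(x) ρ(y) ds(y)` exists and is equal to `a`. -/
def HasDerivSL (v : Plane → Plane) (ρ : Plane → ℝ) (x : Plane) (a : ℝ) : Prop :=
  Tendsto (fun ε : ℝ => ∫ y in {y : Plane | ε < ‖x - y‖},
      lineDeriv ℝ (fun z => greenLaplace z y) x (v x) * ρ y ∂Ω.arcLength)
    (𝓝[>] 0) (𝓝 a)

/-- `Ω.HasDerivSH v μ x t a`: for `x ∈ Γ`, the principal value integral
`p.v. ∫₀ᵗ ∫_Γ ∂G_H(x - y, t - t')/∂v(x) μ(y, t') ds(y) dt'` exists and is equal to `a`. -/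
def HasDerivSH (v : Plane → Plane) (μ : Plane → ℝ → ℝ) (x : Plane) (t a : ℝ) : Prop :=
  Tendsto (fun ε : ℝ => ∫ t' in (0 : ℝ)..t, ∫ y in {y : Plane | ε < ‖x - y‖},
      lineDeriv ℝ (fun z => greenHeat (z - y) (t - t')) x (v x) * μ y t' ∂Ω.arcLength)
    (𝓝[>] 0) (𝓝 a)

/-- `ρ` represents an element of `L²(Γ)` in the nullspace of `½ I + S_Lν`. -/
def IsNeumannNull (ρ : Plane → ℝ) : Prop :=
  MemLp ρ 2 Ω.arcLength ∧
    ∀ᵐ x ∂Ω.arcLength, ∃ a, Ω.HasDerivSL Ω.normal ρ x a ∧ 1 / 2 * ρ x + a = 0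

/-- The nullspace of `½ I + S_Lν` in `L²(Γ)` is one-dimensional, and `ρ₀` spans it. -/
def SpansNeumannNullspace (ρ₀ : Plane → ℝ) : Prop :=
  ¬ ρ₀ =ᵐ[Ω.arcLength] 0 ∧
    ∀ ρ : Plane → ℝ, Ω.IsNeumannNull ρ ↔ ∃ c : ℝ, ρ =ᵐ[Ω.arcLength] fun x => c * ρ₀ x

/-- The measure `ds dt` on the space-time boundary `Γ_T = Γ × [0, T]`. -/
noncomputable def spaceTime (T : ℝ) : Measure (Plane × ℝ) :=
  Ω.arcLength.prod (volume.restrict (Icc 0 T))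

/-- The pair `(ρ, μ)` of densities in `L²(Γ_T)` solves the two-dimensional combined source
integral equation with boundary data `g` on the stationary boundary `Γ`:
`½ρ + S_Lν[ρ] + S_Hτ[μ] = ν · g` and `½μ + S_Hν[μ] - S_Lτ[ρ] = -τ · g`. -/
structure SolvesCSIE (T : ℝ) (ρ μ : Plane → ℝ → ℝ) (g : Plane → ℝ → Plane) : Prop where
  memLp_pressure : MemLp (fun p : Plane × ℝ => ρ p.1 p.2) 2 (Ω.spaceTime T)
  memLp_vortex : MemLp (fun p : Plane × ℝ => μ p.1 p.2) 2 (Ω.spaceTime T)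
  equations : ∀ᵐ p ∂Ω.spaceTime T, ∃ sLν sHτ sHν sLτ : ℝ,
    Ω.HasDerivSL Ω.normal (fun y => ρ y p.2) p.1 sLν ∧
    Ω.HasDerivSH Ω.tangent μ p.1 p.2 sHτ ∧
    Ω.HasDerivSH Ω.normal μ p.1 p.2 sHν ∧
    Ω.HasDerivSL Ω.tangent (fun y => ρ y p.2) p.1 sLτ ∧
    1 / 2 * ρ p.1 p.2 + sLν + sHτ = inner ℝ (Ω.normal p.1) (g p.1 p.2) ∧
    1 / 2 * μ p.1 p.2 + sHν - sLτ = -inner ℝ (Ω.tangent p.1) (g p.1 p.2)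

/-- `(ρ, μ)` lies in the nullspace of the combined source integral equation on `Γ × [0, T]`. -/
def InCSIENullspace (T : ℝ) (ρ μ : Plane → ℝ → ℝ) : Prop :=
  Ω.SolvesCSIE T ρ μ (fun _ _ => 0)

end SmoothJordanDomain

/-!
Identify the plane with `ℂ` and write `c` for the boundary curve in the arc length parameter. Up to
the factor `-1/(2π)`, the single layer potential of a density `ρ` is
`p(z) = ∫ log |z - c(t)| ρ(t) dt`, and `∂ᵥ p = Re (v F)` with the Cauchy-type integral
`F(z) = ∫ ρ(t) / (z - c(t)) dt`. The normal derivative at `c(s)` has the bounded kernel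
`N(s, t) = Im (c'(s) / (c(s) - c(t)))` (`normalKernel`), so that `½ ρ + S_Lν[ρ] = 0` reads
`∫ N(s, t) ρ(t) dt = π ρ(s)`. In particular an `L²` solution has a continuous representative
(`IsNullDensity`), and only continuous densities matter from then on.

The analytic core is one jump relation, `tendsto_cauchyPotential_sub_truncatedCauchy`: at distance
`ε` from `c(s)` along the normal, on the side `σ = ±1`, the function `F` differs from the integral
truncated at `|c(s) - c(t)| > ε` by `i σ π ρ(s) / c'(s)` in the limit. Its normal component says
that the inner normal derivative of `p` vanishes for a null density and that the outer one is `2πρ`.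

* Inside, `p` is then constant (`IsArcDomain.exists_logPotential_eq_const`): a nonconstant `p` would
  attain its maximum over the closure on the boundary only, and Hopf's lemma would give a nonzero
  normal derivative there. Hence `F = 0` inside, and the tangential component of the jump relation
  shows that the principal value `S_Lτ[ρ]` exists and is zero (`IsArcDomain.tendsto_tangential`).
* Outside, if `∫ ρ = 0`, then `p` vanishes at infinity and is constant on the curve, so it attains
  its maximum or its minimum on the curve. The outer normal derivative `2πρ` then has a sign, which
  forces `ρ = 0` (`IsArcDomain.eq_zero_of_integral_eq_zero`). So the nullspace has dimension at most
  one.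
* It is nontrivial by the Fredholm alternative (`IsArcDomain.exists_isNullDensity_ne_zero`): by
  Gauss' formula `∫ N(s, t) ds = π` (`IsArcDomain.integral_normalKernel_left`) every function in the
  range of `π - N` has mean zero, so this operator is not surjective, hence not injective. Gauss' formula
  holds because the angle subtended by the curve at one of its points is an odd multiple of `π`,
  depends continuously on the point, and equals `π` at a rightmost point.

With `S_Lτ[ρ₀] = 0` both integral equations hold for `ρ = ρ₀ f` and `μ = 0`.
-/

open scoped BoundedContinuousFunction

/-! ### Smooth closed curves parametrized by arc length -/

/-- A smooth simple closed curve `c` of length `L` in the complex plane, parametrized by arc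
length. -/
structure IsArcCurve (c : ℝ → ℂ) (L : ℝ) : Prop where
  L_pos : 0 < L
  contDiff : ContDiff ℝ ∞ c
  periodic : Function.Periodic c L
  injOn : InjOn c (Ico 0 L)
  norm_deriv : ∀ s, ‖deriv c s‖ = 1

/-- The kernel `Im (c'(s) / (c(s) - c(t)))`; up to the factor `-1/(2π)` it is the derivative of
Green's function `G_L(x, y)` at `x = c(s)`, `y = c(t)` along the normal `-i c'(s)` at `x`. -/
noncomputable def normalKernel (c : ℝ → ℂ) (s t : ℝ) : ℝ := (deriv c s / (c s - c t)).im

namespace IsArcCurve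

variable {c : ℝ → ℂ} {L : ℝ} (hc : IsArcCurve c L)
include hc

lemma continuous : Continuous c := hc.contDiff.continuous

lemma hasDerivAt (s : ℝ) : HasDerivAt c (deriv c s) s :=
  (hc.contDiff.differentiable (by simp) s).hasDerivAt

lemma contDiff_deriv : ContDiff ℝ ∞ (deriv c) :=
  (contDiff_infty_iff_deriv.mp hc.contDiff).2

lemma continuous_deriv : Continuous (deriv c) := hc.contDiff_deriv.continuous

lemma deriv_ne_zero (s : ℝ) : deriv c s ≠ 0 := by
  intro h; have := hc.norm_deriv s; simp [h] at this

lemma deriv_periodic : Function.Periodic (deriv c) L := by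
  intro s
  rw [← deriv_comp_add_const c L s]
  congr 1
  exact funext hc.periodic

lemma norm_chord_le (s t : ℝ) : ‖c t - c s‖ ≤ |t - s| := by
  have := Convex.norm_image_sub_le_of_norm_hasDerivWithin_le (f := c) (f' := deriv c) (C := 1)
    (s := univ) (x := s) (y := t) (fun x _ => (hc.hasDerivAt x).hasDerivWithinAt)
    (fun x _ => (hc.norm_deriv x).le) convex_univ trivial trivial
  simpa using this

/-- Every parameter is congruent modulo `L` to one at distance at most `L / 2` from `s`. -/
lemma exists_near (s t : ℝ) : ∃ h, |h| ≤ L / 2 ∧ c (s + h) = c t := by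
  have hL := hc.L_pos
  refine ⟨t - s - round ((t - s) / L) * L, ?_, ?_⟩
  · have h1 := abs_sub_round ((t - s) / L)
    have h2 : t - s - round ((t - s) / L) * L = ((t - s) / L - round ((t - s) / L)) * L := by
      field_simp
    rw [h2, abs_mul, abs_of_pos hL]
    nlinarith
  · rw [show s + (t - s - round ((t - s) / L) * L) = t - round ((t - s) / L) * L by ring]
    exact hc.periodic.sub_int_mul_eq _

lemma eq_of_apply_eq {s t : ℝ} (h : c s = c t) : ∃ k : ℤ, s = t + k * L := by
  have hL := hc.L_pos
  have key : ∀ x, ∃ k : ℤ, x - k * L ∈ Ico 0 L := fun x => by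
    refine ⟨⌊x / L⌋, ?_, ?_⟩
    · have := Int.floor_le (x / L)
      rw [le_div_iff₀ hL] at this; linarith
    · have := Int.lt_floor_add_one (x / L)
      rw [div_lt_iff₀ hL] at this; linarith
  obtain ⟨k, hk⟩ := key s
  obtain ⟨l, hl⟩ := key t
  have := hc.injOn hk hl (by
    rw [hc.periodic.sub_int_mul_eq, hc.periodic.sub_int_mul_eq, h])
  refine ⟨k - l, ?_⟩
  push_cast; linarith

/-- First order Taylor expansion, uniformly on the curve. -/
lemma exists_taylor : ∃ C, 0 < C ∧ ∀ s h, ‖c (s + h) - c s - h * deriv c s‖ ≤ C * h ^ 2 := by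
  have hd2 : Continuous (deriv (deriv c)) :=
    (contDiff_infty_iff_deriv.mp hc.contDiff_deriv).2.continuous
  have hper : Function.Periodic (deriv (deriv c)) L := by
    intro s
    rw [← deriv_comp_add_const (deriv c) L s]
    congr 1
    exact funext hc.deriv_periodic
  obtain ⟨C₀, hC₀⟩ := (hper.isBounded_of_continuous hc.L_pos.ne' hd2).exists_norm_le
  have hC : ∀ s, ‖deriv (deriv c) s‖ ≤ |C₀| + 1 := fun s =>
    (hC₀ _ ⟨s, rfl⟩).trans (by linarith [le_abs_self C₀])
  refine ⟨|C₀| + 1, by positivity, fun s h => ?_⟩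
  set C := |C₀| + 1
  have hLip : ∀ x y, ‖deriv c y - deriv c x‖ ≤ C * |y - x| := fun x y => by
    have := Convex.norm_image_sub_le_of_norm_hasDerivWithin_le (f := deriv c)
      (f' := deriv (deriv c)) (C := C)
      (s := univ) (x := x) (y := y)
      (fun x _ => ((hc.contDiff_deriv.differentiable (by simp)) x).hasDerivAt.hasDerivWithinAt)
      (fun x _ => hC x) convex_univ trivial trivial
    simpa using this
  have := Convex.norm_image_sub_le_of_norm_hasDerivWithin_le
    (f := fun x : ℝ => c (s + x) - x * deriv c s)
    (f' := fun x => deriv c (s + x) - deriv c s) (C := C * |h|)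
    (s := uIcc 0 h) (x := 0) (y := h) (fun x _ => by
      have h1 : HasDerivAt (fun x : ℝ => c (s + x)) (deriv c (s + x)) x :=
        (hc.hasDerivAt (s + x)).comp_const_add s x
      have h2 : HasDerivAt (fun x : ℝ => (x : ℂ) * deriv c s) (deriv c s) x := by
        simpa using (Complex.ofRealCLM.hasDerivAt (x := x)).mul_const (deriv c s)
      exact (h1.sub h2).hasDerivWithinAt)
    (fun x hx => by
      refine (hLip s (s + x)).trans ?_
      have : |x| ≤ |h| := by
        have := abs_sub_left_of_mem_uIcc hx
        simpa using this
      simp only [add_sub_cancel_left]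
      gcongr) (convex_uIcc 0 h) left_mem_uIcc right_mem_uIcc
  simp only [add_zero, Complex.ofReal_zero, zero_mul, sub_zero, Real.norm_eq_abs] at this
  calc ‖c (s + h) - c s - h * deriv c s‖ = ‖c (s + h) - h * deriv c s - c s‖ := by congr 1; ring
    _ ≤ C * |h| * |h| := this
    _ = C * h ^ 2 := by rw [mul_assoc, ← sq, sq_abs]

/-- The chord-arc inequality. -/
lemma exists_chord_arc : ∃ κ, 0 < κ ∧ ∀ s h, |h| ≤ L / 2 → κ * |h| ≤ ‖c (s + h) - c s‖ := by
  have hL := hc.L_pos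
  obtain ⟨C, hC, hT⟩ := hc.exists_taylor
  have hnear : ∀ s h, |h| ≤ 1 / (2 * C) → (1 / 2) * |h| ≤ ‖c (s + h) - c s‖ := fun s h hh => by
    have h1 := hT s h
    have h2 : ‖(h : ℂ) * deriv c s‖ = |h| := by simp [hc.norm_deriv]
    have h3 := norm_sub_norm_le ((h : ℂ) * deriv c s) (h * deriv c s - (c (s + h) - c s))
    rw [h2, sub_sub_cancel, norm_sub_rev (h * deriv c s)] at h3
    have h4 : C * h ^ 2 ≤ 1 / 2 * |h| := by
      rw [← sq_abs]
      rw [le_div_iff₀ (by positivity)] at hh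
      nlinarith [abs_nonneg h]
    linarith
  -- Away from the diagonal the chord is bounded below by compactness.
  let K : Set (ℝ × ℝ) := Icc 0 L ×ˢ {h | 1 / (2 * C) ≤ |h| ∧ |h| ≤ L / 2}
  have hKc : IsCompact K := by
    refine isCompact_Icc.prod ?_
    refine (isCompact_Icc (a := -(L / 2)) (b := L / 2)).of_isClosed_subset ?_ ?_
    · exact (isClosed_le continuous_const continuous_abs).inter
        (isClosed_le continuous_abs continuous_const)
    · exact fun h hh => abs_le.mp hh.2
  have hfar : ∃ m, 0 < m ∧ ∀ p ∈ K, m ≤ ‖c (p.1 + p.2) - c p.1‖ := by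
    have hcont := hc.continuous
    refine hKc.exists_forall_le' (f := fun p : ℝ × ℝ => ‖c (p.1 + p.2) - c p.1‖)
      (by fun_prop) (a := 0) ?_
    rintro ⟨s, h⟩ ⟨-, h1, h2⟩
    simp only [norm_pos_iff, sub_ne_zero]
    intro heq
    obtain ⟨k, hk⟩ := hc.eq_of_apply_eq heq
    have hk' : h = k * L := by linarith
    have h0 : 0 < |h| := lt_of_lt_of_le (by positivity) h1
    rw [hk', abs_mul, abs_of_pos hL] at h2 h0
    have hk0 : (1 : ℝ) ≤ |(k : ℝ)| := by
      have : k ≠ 0 := by rintro rfl; simp at h0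
      exact_mod_cast Int.one_le_abs this
    nlinarith
  obtain ⟨m, hm, hmK⟩ := hfar
  refine ⟨min (1 / 2) (2 * m / L), by positivity, fun s h hh => ?_⟩
  by_cases hs : |h| ≤ 1 / (2 * C)
  · exact le_trans (by gcongr; exact min_le_left _ _) (hnear s h hs)
  · push Not at hs
    obtain ⟨x, hx0, hx⟩ : ∃ x ∈ Ico 0 (0 + L), c s = c x ∧ c (s + h) = c (x + h) := by
      obtain ⟨x, hx, h1⟩ := hc.periodic.exists_mem_Ico
        (f := c) hL s 0
      obtain ⟨k, hk⟩ := hc.eq_of_apply_eq h1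
      refine ⟨x, hx, h1, ?_⟩
      rw [hk, add_right_comm]
      exact (hc.periodic.int_mul k) _
    rw [hx.1, hx.2]
    refine le_trans ?_ (hmK (x, h) ⟨⟨hx0.1, by linarith [hx0.2]⟩, hs.le, hh⟩)
    calc min (1 / 2) (2 * m / L) * |h| ≤ 2 * m / L * (L / 2) := by
          gcongr; exact min_le_right _ _
      _ = m := by field_simp

/-- The chord deviates from the tangent by a multiple of its squared length. -/
lemma exists_im_mul_conj_le : ∃ C, 0 < C ∧ ∀ s t,
    |(deriv c s * (starRingEnd ℂ) (c t - c s)).im| ≤ C * ‖c t - c s‖ ^ 2 := by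
  obtain ⟨C, hC, hT⟩ := hc.exists_taylor
  obtain ⟨κ, hκ, hch⟩ := hc.exists_chord_arc
  refine ⟨C / κ ^ 2, by positivity, fun s t => ?_⟩
  obtain ⟨h, hh, heq⟩ := hc.exists_near s t
  rw [← heq]
  have h1 := hT s h
  have h2 := hch s h hh
  have h3 : (deriv c s * (starRingEnd ℂ) (c (s + h) - c s)).im
      = (deriv c s * (starRingEnd ℂ) (c (s + h) - c s - h * deriv c s)).im := by
    simp only [Complex.mul_im, map_sub, map_mul, Complex.conj_ofReal, Complex.sub_im,
      Complex.sub_re, Complex.conj_re, Complex.conj_im, Complex.ofReal_re, Complex.ofReal_im,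
      Complex.mul_re]
    ring
  rw [h3]
  calc _ ≤ ‖deriv c s * (starRingEnd ℂ) (c (s + h) - c s - h * deriv c s)‖ :=
        Complex.abs_im_le_norm _
    _ ≤ C * h ^ 2 := by rw [norm_mul, hc.norm_deriv, one_mul, RCLike.norm_conj]; exact h1
    _ = C / κ ^ 2 * (κ * |h|) ^ 2 := by rw [mul_pow, sq_abs]; field_simp
    _ ≤ _ := by gcongr

/-- The normal derivative kernel is bounded, since the curve is `C²`. -/
lemma exists_normalKernel_le : ∃ C, 0 < C ∧ ∀ s t, |normalKernel c s t| ≤ C := by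
  obtain ⟨C, hC, hT⟩ := hc.exists_im_mul_conj_le
  refine ⟨C, hC, fun s t => ?_⟩
  unfold normalKernel
  by_cases h0 : c s - c t = 0
  · simp [h0, hC.le]
  have h1 := hT s t
  have hpos : 0 < ‖c t - c s‖ := by rw [norm_sub_rev]; exact norm_pos_iff.mpr h0
  have : (deriv c s / (c s - c t)).im
      = -((deriv c s * (starRingEnd ℂ) (c t - c s)).im / ‖c t - c s‖ ^ 2) := by
    rw [norm_sub_rev, div_eq_mul_inv, Complex.inv_def, ← Complex.normSq_eq_norm_sq, ← mul_assoc,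
      Complex.im_mul_ofReal, ← neg_div, ← Complex.neg_im, ← mul_neg, ← map_neg, neg_sub,
      div_eq_mul_inv]
  rw [this, abs_neg, abs_div, abs_of_pos (pow_pos hpos 2)]
  rw [div_le_iff₀ (pow_pos hpos 2)]
  exact h1

end IsArcCurve

/-! ### The jump relation for Cauchy-type integrals -/

/-- The Cauchy-type integral `∫ ρ(t) / (z - c(t)) dt`; it is `∂ₓ - i ∂ᵧ` of the logarithmic
potential `∫ log |z - c(t)| ρ(t) dt`. -/
noncomputable def cauchyPotential (c : ℝ → ℂ) (L : ℝ) (ρ : ℝ → ℝ) (z : ℂ) : ℂ :=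
  ∫ t in (0 : ℝ)..L, (ρ t : ℂ) / (z - c t)

/-- The Cauchy-type integral at the point `c(s)` of the curve, truncated to the part of the curve
at distance more than `ε` from that point. -/
noncomputable def truncatedCauchy (c : ℝ → ℂ) (L : ℝ) (ρ : ℝ → ℝ) (s ε : ℝ) : ℂ :=
  ∫ t in (0 : ℝ)..L, {t | ε < ‖c s - c t‖}.indicator (fun t => (ρ t : ℂ) / (c s - c t)) t

/-- The difference of the kernels of `cauchyPotential` at distance `ε` from the curve and of
`truncatedCauchy`, in the rescaled variable `q = (c(s + ε r) - c(s)) / ε`; the vector `w` is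
the unit normal pointing to the side of the evaluation point. -/
noncomputable def jumpKernel (w q : ℂ) : ℂ :=
  1 / (w - q) + {q : ℂ | 1 < ‖q‖}.indicator (fun q => 1 / q) q

lemma norm_jumpKernel_le {w q : ℂ} {κ r : ℝ} (hw : ‖w‖ = 1) (hκ : 0 < κ) (h1 : κ * |r| ≤ ‖q‖)
    (h2 : ‖q‖ ≤ |r|) (h3 : (1 + ‖q‖ ^ 2) / 2 ≤ ‖w - q‖ ^ 2) :
    ‖jumpKernel w q‖ ≤ (4 / κ ^ 2 + 2) * (1 + r ^ 2)⁻¹ := by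
  have hwq : 0 < ‖w - q‖ := by
    by_contra h
    have : ‖w - q‖ = 0 := le_antisymm (not_lt.mp h) (norm_nonneg _)
    rw [this] at h3
    nlinarith [sq_nonneg ‖q‖]
  have hr : (κ * |r|) ^ 2 ≤ ‖q‖ ^ 2 := by gcongr
  rw [mul_pow, sq_abs] at hr
  rw [← div_eq_mul_inv, le_div_iff₀ (by positivity)]
  unfold jumpKernel
  by_cases hq : 1 < ‖q‖
  -- The two fractions cancel to second order at infinity.
  · have hq0 : 0 < ‖q‖ := by linarith
    have hrr : ‖q‖ ^ 2 ≤ r ^ 2 := by rw [← sq_abs r]; gcongr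
    have e : 1 / (w - q) + {q : ℂ | 1 < ‖q‖}.indicator (fun q => 1 / q) q
        = w / ((w - q) * q) := by
      rw [indicator_of_mem (by exact hq)]
      have : w - q ≠ 0 := norm_pos_iff.mp hwq
      have : q ≠ 0 := norm_pos_iff.mp hq0
      field_simp
      ring
    rw [e, norm_div, norm_mul, hw]
    have h4 : ‖q‖ / 2 ≤ ‖w - q‖ := by
      refine le_of_sq_le_sq ?_ hwq.le
      nlinarith
    have h5 : 1 / (‖w - q‖ * ‖q‖) ≤ 1 / (‖q‖ / 2 * ‖q‖) := by gcongr
    calc 1 / (‖w - q‖ * ‖q‖) * (1 + r ^ 2) ≤ 1 / (‖q‖ / 2 * ‖q‖) * (2 * r ^ 2) := by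
          gcongr; nlinarith
      _ = 4 * (κ ^ 2 * r ^ 2 / ‖q‖ ^ 2) / κ ^ 2 := by field_simp; ring
      _ ≤ 4 * 1 / κ ^ 2 := by
          gcongr
          rw [div_le_one (by positivity)]
          exact hr
      _ ≤ _ := by rw [mul_one]; linarith
  · rw [indicator_of_notMem (by exact hq), add_zero, norm_div, norm_one]
    have h4 : 1 / 2 ≤ ‖w - q‖ := by
      refine le_of_sq_le_sq ?_ hwq.le
      nlinarith [sq_nonneg ‖q‖]
    have h5 : 1 / ‖w - q‖ ≤ 2 := by
      rw [div_le_iff₀ hwq]; linarith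
    have h6 : r ^ 2 ≤ 1 / κ ^ 2 := by
      rw [le_div_iff₀ (by positivity)]
      nlinarith [norm_nonneg q]
    calc 1 / ‖w - q‖ * (1 + r ^ 2) ≤ 2 * (1 + 1 / κ ^ 2) := by gcongr
      _ ≤ _ := by
        have : 0 < 1 / κ ^ 2 := by positivity
        rw [show 4 / κ ^ 2 = 4 * (1 / κ ^ 2) by ring]
        linarith

/-- The integral of the limit kernel over the tangent line produces the jump. -/
lemma integral_jumpKernel {τ : ℂ} (hτ : ‖τ‖ = 1) {σ : ℝ} (hσ : σ ^ 2 = 1) :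
    ∫ r : ℝ, jumpKernel (σ * (-Complex.I * τ)) (r * τ) = σ * Real.pi * Complex.I / τ := by
  have hτ0 : τ ≠ 0 := by rintro rfl; simp at hτ
  let g : ℝ → ℝ := fun r => -r / (1 + r ^ 2) + {r : ℝ | 1 < |r|}.indicator (fun r => 1 / r) r
  have hσ' : (σ : ℂ) ^ 2 = 1 := by exact_mod_cast hσ
  have hker : ∀ r : ℝ, jumpKernel (σ * (-Complex.I * τ)) (r * τ)
      = (σ * Complex.I / τ) * ((1 + r ^ 2)⁻¹ : ℝ) + (1 / τ) * (g r : ℝ) := fun r => by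
    have h0 : (1 + (r : ℂ) ^ 2) ≠ 0 := by
      exact_mod_cast (by positivity : (1 + r ^ 2 : ℝ) ≠ 0)
    have hfac : (1 : ℂ) + r ^ 2 = (-(σ * Complex.I) - r) * (σ * Complex.I - r) := by
      linear_combination (σ : ℂ) ^ 2 * Complex.I_sq - hσ'
    have h1 : (-(σ * Complex.I) - r : ℂ) ≠ 0 := fun h => h0 (by rw [hfac, h, zero_mul])
    have hA : 1 / ((σ : ℂ) * (-Complex.I * τ) - r * τ)
        = (σ * Complex.I / τ) * ((1 + r ^ 2)⁻¹ : ℝ) + (1 / τ) * (-r / (1 + r ^ 2) : ℝ) := by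
      rw [show (σ : ℂ) * (-Complex.I * τ) - r * τ = (-(σ * Complex.I) - r) * τ by ring]
      push_cast
      rw [div_eq_iff (mul_ne_zero h1 hτ0)]
      field_simp
      rw [hfac]; ring
    have hB : {q : ℂ | 1 < ‖q‖}.indicator (fun q => 1 / q) ((r : ℂ) * τ)
        = (1 / τ) * ({r : ℝ | 1 < |r|}.indicator (fun r => 1 / r) r : ℝ) := by
      by_cases hr : 1 < |r|
      · rw [indicator_of_mem (by simpa [hτ] using hr), indicator_of_mem (by exact hr)]
        push_cast
        rw [one_div_mul_one_div, mul_comm]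
      · rw [indicator_of_notMem (by simpa [hτ] using hr), indicator_of_notMem (by exact hr)]
        simp
    unfold jumpKernel
    rw [hA, hB]
    simp only [g]
    push_cast
    ring
  have hgm : Measurable g := by
    refine Measurable.add (by fun_prop) (Measurable.indicator (by fun_prop) ?_)
    exact measurableSet_lt measurable_const measurable_norm
  have hgb : ∀ r, ‖g r‖ ≤ 2 * (1 + r ^ 2)⁻¹ := fun r => by
    rw [← div_eq_mul_inv, le_div_iff₀ (by positivity), Real.norm_eq_abs]
    simp only [g]
    by_cases hr : 1 < |r|
    · rw [indicator_of_mem (by exact hr)]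
      have hr0 : r ≠ 0 := by rintro rfl; simp at hr; linarith
      have : -r / (1 + r ^ 2) + 1 / r = 1 / (r * (1 + r ^ 2)) := by
        field_simp; ring
      rw [this, abs_div, abs_mul, abs_one, abs_of_pos (by positivity : 0 < 1 + r ^ 2)]
      have : 0 < |r| := by linarith
      rw [div_mul_eq_mul_div, div_le_iff₀ (by positivity)]
      nlinarith [sq_nonneg r]
    · rw [indicator_of_notMem (by exact hr), add_zero, abs_div, abs_neg,
        abs_of_pos (by positivity : 0 < 1 + r ^ 2), div_mul_cancel₀ _ (by positivity)]
      linarith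
  have hgi : Integrable g := (integrable_inv_one_add_sq.const_mul 2).mono'
    hgm.aestronglyMeasurable (Eventually.of_forall hgb)
  -- The tangential part of the kernel is odd.
  have hg0 : ∫ r, g r = 0 := by
    have h1 : ∫ r, g (-r) = ∫ r, g r := integral_neg_eq_self g volume
    have h2 : ∀ r, g (-r) = - g r := fun r => by
      simp only [g]
      by_cases hr : 1 < |r|
      · rw [indicator_of_mem (by rw [mem_ofPred_eq, abs_neg]; exact hr),
          indicator_of_mem (by exact hr)]
        rw [neg_sq, div_neg]; ring
      · rw [indicator_of_notMem (by rw [mem_ofPred_eq, abs_neg]; exact hr),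
          indicator_of_notMem (by exact hr)]
        rw [neg_sq]; ring
    simp_rw [h2, integral_neg] at h1
    linarith
  simp_rw [hker]
  rw [integral_add (integrable_inv_one_add_sq.ofReal.const_mul _) (hgi.ofReal.const_mul _),
    integral_const_mul, integral_const_mul, integral_complex_ofReal, integral_complex_ofReal, hg0,
    integral_univ_inv_one_add_sq]
  simp
  ring

namespace IsArcCurve

variable {c : ℝ → ℂ} {L : ℝ} (hc : IsArcCurve c L)
include hc

/-- Points on the normal near the curve stay away from the curve. -/
lemma exists_normal_estimate : ∃ δ, 0 < δ ∧ ∀ (σ ε s t : ℝ), σ ^ 2 = 1 → 0 < ε → ε < δ →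
    ε ^ 2 + ‖c t - c s‖ ^ 2 / 2
      ≤ ‖c s + σ * ε * (-Complex.I * deriv c s) - c t‖ ^ 2 := by
  obtain ⟨C, hC, hT⟩ := hc.exists_im_mul_conj_le
  refine ⟨1 / (4 * C), by positivity, fun σ ε s t hσ hε hδ => ?_⟩
  have h1 := hT s t
  set τ := deriv c s with hτ
  have hτ1 : τ.re ^ 2 + τ.im ^ 2 = 1 := by
    have := hc.norm_deriv s
    rw [← hτ] at this
    have h2 := Complex.normSq_eq_norm_sq τ
    rw [this, Complex.normSq_apply] at h2
    linarith
  set q := c t - c s with hq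
  have e1 : c s + σ * ε * (-Complex.I * τ) - c t = σ * ε * (-Complex.I * τ) - q := by
    rw [hq]; ring
  have e2 : ‖(σ : ℂ) * ε * (-Complex.I * τ) - q‖ ^ 2
      = ε ^ 2 - 2 * σ * ε * (τ * (starRingEnd ℂ) q).im + ‖q‖ ^ 2 := by
    rw [← Complex.normSq_eq_norm_sq, ← Complex.normSq_eq_norm_sq, Complex.normSq_apply,
      Complex.normSq_apply]
    simp only [Complex.sub_re, Complex.mul_re, Complex.sub_im, Complex.mul_im, Complex.ofReal_re,
      Complex.ofReal_im, Complex.neg_re, Complex.neg_im, Complex.I_re, Complex.I_im,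
      Complex.conj_re, Complex.conj_im]
    linear_combination (σ ^ 2 * ε ^ 2) * hτ1 + ε ^ 2 * hσ
  rw [e1, e2]
  set J := (τ * (starRingEnd ℂ) q).im
  have h3 : |2 * σ * ε * J| ≤ 2 * ε * (C * ‖q‖ ^ 2) := by
    have : |σ| = 1 := by rwa [← sq_eq_sq₀ (abs_nonneg _) zero_le_one, sq_abs, one_pow]
    rw [abs_mul, abs_mul, abs_mul, this, abs_of_pos hε, abs_two, mul_one]
    gcongr
  have h4 : 2 * ε * (C * ‖q‖ ^ 2) ≤ ‖q‖ ^ 2 / 2 := by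
    rw [lt_div_iff₀ (by positivity)] at hδ
    nlinarith [sq_nonneg ‖q‖]
  nlinarith [le_abs_self (2 * σ * ε * J), sq_nonneg ε]

/-- Rescaled around a point, the curve converges to its tangent line. -/
lemma tendsto_scaled_chord (s r : ℝ) :
    Tendsto (fun ε : ℝ => (c (s + ε * r) - c s) / ε) (𝓝[>] 0) (𝓝 (r * deriv c s)) := by
  have h1 : HasDerivAt (fun ε : ℝ => c (s + ε * r)) (r * deriv c s) 0 := by
    have h2 : HasDerivAt (fun ε : ℝ => s + ε * r) r 0 := by
      simpa using ((hasDerivAt_id (0 : ℝ)).mul_const r).const_add s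
    have h3 : HasDerivAt c (deriv c s) (s + 0 * r) := by simpa using hc.hasDerivAt s
    simpa [Function.comp_def] using h3.scomp (0 : ℝ) h2
  have := h1.tendsto_slope.mono_left (nhdsWithin_mono 0 (fun x (hx : 0 < x) => hx.ne'))
  refine this.congr fun ε => ?_
  simp [slope, div_eq_inv_mul]

lemma tendsto_jumpKernel (s r : ℝ) {w : ℂ} (hw : w - r * deriv c s ≠ 0) (hr : |r| ≠ 1) :
    Tendsto (fun ε : ℝ => jumpKernel w ((c (s + ε * r) - c s) / ε)) (𝓝[>] 0)
      (𝓝 (jumpKernel w (r * deriv c s))) := by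
  refine Tendsto.comp (g := jumpKernel w) (y := 𝓝 (r * deriv c s)) ?_
    (hc.tendsto_scaled_chord s r)
  have hn : ‖(r : ℂ) * deriv c s‖ = |r| := by simp [hc.norm_deriv]
  refine Tendsto.add ?_ ?_
  · exact (continuousAt_const.div (continuousAt_const.sub continuousAt_id) hw).tendsto
  · rcases lt_or_gt_of_ne hr with h | h
    · rw [indicator_of_notMem (by simp only [mem_ofPred_eq, hn]; linarith)]
      refine tendsto_const_nhds.congr' ?_
      have : ∀ᶠ q : ℂ in 𝓝 (r * deriv c s), ‖q‖ < 1 :=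
        continuous_norm.continuousAt.eventually_lt_const (hn.trans_lt h)
      filter_upwards [this] with q hq
      rw [indicator_of_notMem (by simp only [mem_ofPred_eq]; linarith)]
    · rw [indicator_of_mem (by simpa only [mem_ofPred_eq, hn] using h)]
      have : ∀ᶠ q : ℂ in 𝓝 (r * deriv c s), 1 < ‖q‖ :=
        continuous_norm.continuousAt.eventually_const_lt (h.trans_eq hn.symm)
      refine Tendsto.congr' (f₁ := fun q => 1 / q) ?_ ?_
      · filter_upwards [this] with q hq
        rw [indicator_of_mem (by exact hq)]
      · refine (continuousAt_const.div continuousAt_id ?_).tendsto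
        exact norm_pos_iff.mp (by simp only [id]; rw [hn]; linarith)

variable {ρ : ℝ → ℝ}

lemma measurable_truncated (hρ : Continuous ρ) (s ε : ℝ) :
    Measurable ({t | ε < ‖c s - c t‖}.indicator (fun t => (ρ t : ℂ) / (c s - c t))) := by
  have hcc := hc.continuous
  refine Measurable.indicator ?_ (measurableSet_lt measurable_const (by fun_prop))
  exact (by fun_prop : Measurable fun t => (ρ t : ℂ)).div (by fun_prop)

lemma intervalIntegrable_truncated (hρ : Continuous ρ) (s : ℝ) {ε : ℝ} (hε : 0 < ε) (a b : ℝ) :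
    IntervalIntegrable ({t | ε < ‖c s - c t‖}.indicator (fun t => (ρ t : ℂ) / (c s - c t)))
      volume a b := by
  refine ((hρ.norm.div_const ε).intervalIntegrable a b).mono_fun
    (hc.measurable_truncated hρ s ε).aestronglyMeasurable (Eventually.of_forall fun t => ?_)
  beta_reduce
  by_cases ht : ε < ‖c s - c t‖
  · rw [indicator_of_mem (by exact ht), norm_div, norm_div, norm_norm, Complex.norm_real,
      Real.norm_of_nonneg hε.le]
    gcongr
  · rw [indicator_of_notMem (by exact ht), norm_zero]
    positivity

/-- **Jump relation** in complex form: near the curve, on the side `σ = ±1` of it, the Cauchy-type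
integral differs from its truncation at the scale of the distance by `i σ π ρ / c'` in the
limit. The proof rescales `t = s + ε r` and passes to the limit by dominated convergence. -/
theorem tendsto_cauchyPotential_sub_truncatedCauchy (hρ : Continuous ρ)
    (hp : Function.Periodic ρ L) (s : ℝ) {σ : ℝ} (hσ : σ ^ 2 = 1) :
    Tendsto (fun ε : ℝ => cauchyPotential c L ρ (c s + σ * ε * (-Complex.I * deriv c s))
        - truncatedCauchy c L ρ s ε) (𝓝[>] 0)
      (𝓝 (σ * Real.pi * Complex.I * ρ s / deriv c s)) := by
  have hL := hc.L_pos
  obtain ⟨δ, hδ, hnorm⟩ := hc.exists_normal_estimate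
  obtain ⟨κ, hκ, hch⟩ := hc.exists_chord_arc
  obtain ⟨M, hM⟩ := (hp.isBounded_of_continuous hL.ne' hρ).exists_norm_le
  have hM' : ∀ t, ‖ρ t‖ ≤ M := fun t => hM _ ⟨t, rfl⟩
  have hcc := hc.continuous
  set τ := deriv c s with hτ
  set w : ℂ := σ * (-Complex.I * τ) with hw
  have hτ1 : ‖τ‖ = 1 := hc.norm_deriv s
  have hσ1 : |σ| = 1 := by rwa [← sq_eq_sq₀ (abs_nonneg _) zero_le_one, sq_abs, one_pow]
  have hw1 : ‖w‖ = 1 := by rw [hw]; simp [hτ1, hσ1]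
  -- The rescaled integrand.
  let G : ℝ → ℝ → ℂ := fun ε r => (Ioc (-(L / 2) / ε) (L / 2 / ε)).indicator
    (fun r => jumpKernel w ((c (s + ε * r) - c s) / ε) * ρ (s + ε * r)) r
  have hGeq : ∀ ε, 0 < ε → ε < δ → ∫ r, G ε r
      = cauchyPotential c L ρ (c s + σ * ε * (-Complex.I * τ)) - truncatedCauchy c L ρ s ε := by
    intro ε hε hεδ
    have hne : ∀ t, c s + σ * ε * (-Complex.I * τ) - c t ≠ 0 := fun t h => by
      have := hnorm σ ε s t hσ hε hεδ
      rw [h] at this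
      simp only [norm_zero] at this
      nlinarith [sq_nonneg ‖c t - c s‖, pow_pos hε 2]
    let φ : ℝ → ℂ := fun t => (ρ t : ℂ) / (c s + σ * ε * (-Complex.I * τ) - c t)
        - {t | ε < ‖c s - c t‖}.indicator (fun t => (ρ t : ℂ) / (c s - c t)) t
    have hφp : Function.Periodic φ L := fun t => by
      simp only [φ, indicator, mem_ofPred_eq, hp t, hc.periodic t]
    have e1 : cauchyPotential c L ρ (c s + σ * ε * (-Complex.I * τ)) - truncatedCauchy c L ρ s ε
        = ∫ t in (0 : ℝ)..L, φ t := by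
      unfold cauchyPotential truncatedCauchy
      rw [← intervalIntegral.integral_sub _ (hc.intervalIntegrable_truncated hρ s hε 0 L)]
      refine Continuous.intervalIntegrable ?_ _ _
      exact (by fun_prop : Continuous fun t => (ρ t : ℂ)).div (by fun_prop) hne
    have e2 : ∫ t in (0 : ℝ)..L, φ t = ∫ t in (s - L / 2)..(s + L / 2), φ t := by
      have := hφp.intervalIntegral_add_eq 0 (s - L / 2)
      rw [zero_add] at this
      rw [this]; congr 1; ring
    have e3 : ∫ t in (s - L / 2)..(s + L / 2), φ t
        = ∫ r in (-(L / 2) / ε)..(L / 2 / ε), ε • φ (ε * r + s) := by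
      rw [intervalIntegral.integral_smul, intervalIntegral.smul_integral_comp_mul_add]
      congr 1 <;> field_simp <;> ring
    rw [e1, e2, e3, intervalIntegral.integral_of_le (by gcongr; linarith),
      ← integral_indicator measurableSet_Ioc]
    refine integral_congr_ae (Eventually.of_forall fun r => ?_)
    simp only [G]
    congr 1
    ext r
    simp only [φ, jumpKernel, add_comm (ε * r) s]
    have hε' : (ε : ℂ) ≠ 0 := by exact_mod_cast hε.ne'
    have hn1 := hne (s + ε * r)
    have f1 : 1 / (w - (c (s + ε * r) - c s) / ε)
        = ε / (c s + σ * ε * (-Complex.I * τ) - c (s + ε * r)) := by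
      have : w - (c (s + ε * r) - c s) / ε
          = (c s + σ * ε * (-Complex.I * τ) - c (s + ε * r)) / ε := by
        rw [hw]; field_simp; ring
      rw [this, one_div_div]
    have f2 : {q : ℂ | 1 < ‖q‖}.indicator (fun q => 1 / q) ((c (s + ε * r) - c s) / ε)
          * ρ (s + ε * r)
        = -(ε * {t | ε < ‖c s - c t‖}.indicator (fun t => (ρ t : ℂ) / (c s - c t))
          (s + ε * r)) := by
      have hiff : 1 < ‖(c (s + ε * r) - c s) / (ε : ℂ)‖ ↔ ε < ‖c s - c (s + ε * r)‖ := by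
        rw [norm_div, Complex.norm_real, Real.norm_of_nonneg hε.le, lt_div_iff₀ hε, one_mul,
          norm_sub_rev]
      by_cases hq : ε < ‖c s - c (s + ε * r)‖
      · rw [indicator_of_mem (by exact hiff.mpr hq), indicator_of_mem (by exact hq)]
        have h0 : c s - c (s + ε * r) ≠ 0 := norm_pos_iff.mp (hε.trans hq)
        have h0' : c (s + ε * r) - c s ≠ 0 := by rw [← neg_sub]; exact neg_ne_zero.mpr h0
        rw [← neg_sub (c (s + ε * r)) (c s), div_neg]
        field_simp
      · rw [indicator_of_notMem (by rw [mem_ofPred_eq, hiff]; exact hq),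
          indicator_of_notMem (by exact hq)]
        simp
    rw [add_mul, f1, f2, Complex.real_smul]
    ring
  have hlim : Tendsto (fun ε => ∫ r, G ε r) (𝓝[>] 0)
      (𝓝 (∫ r : ℝ, jumpKernel w (r * τ) * ρ s)) := by
    refine tendsto_integral_filter_of_dominated_convergence
      (fun r => (4 / κ ^ 2 + 2) * (1 + r ^ 2)⁻¹ * M) ?_ ?_ ?_ ?_
    · refine Eventually.of_forall fun ε => ?_
      refine (Measurable.indicator ?_ measurableSet_Ioc).aestronglyMeasurable
      refine Measurable.mul ?_ (by fun_prop)
      have hm : Measurable fun r : ℝ => (c (s + ε * r) - c s) / ε := by fun_prop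
      have hj : Measurable (jumpKernel w) := by
        unfold jumpKernel
        refine Measurable.add (by fun_prop) (Measurable.indicator (by fun_prop) ?_)
        exact measurableSet_lt measurable_const measurable_norm
      exact hj.comp hm
    · have : ∀ᶠ ε : ℝ in 𝓝[>] 0, ε < δ := nhdsWithin_le_nhds (Iio_mem_nhds hδ)
      filter_upwards [this, self_mem_nhdsWithin] with ε hεδ (hε : 0 < ε)
      refine Eventually.of_forall fun r => ?_
      have hM0 : 0 ≤ M := (norm_nonneg _).trans (hM' 0)
      simp only [G]
      by_cases hr : r ∈ Ioc (-(L / 2) / ε) (L / 2 / ε)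
      · rw [indicator_of_mem hr, norm_mul, Complex.norm_real]
        refine mul_le_mul ?_ (hM' _) (norm_nonneg _) (by positivity)
        have hnq : ‖(c (s + ε * r) - c s) / (ε : ℂ)‖ = ‖c (s + ε * r) - c s‖ / ε := by
          rw [norm_div, Complex.norm_real, Real.norm_of_nonneg hε.le]
        have habs : |ε * r| = ε * |r| := by rw [abs_mul, abs_of_pos hε]
        refine norm_jumpKernel_le hw1 hκ ?_ ?_ ?_
        · rw [hnq, le_div_iff₀ hε]
          have := hch s (ε * r) (by
            rw [abs_le]
            have h1 := hr.1; have h2 := hr.2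
            rw [div_lt_iff₀ hε] at h1
            rw [le_div_iff₀ hε] at h2
            constructor <;> linarith)
          rw [habs] at this; linarith
        · rw [hnq, div_le_iff₀ hε]
          have := hc.norm_chord_le s (s + ε * r)
          rw [add_sub_cancel_left, habs] at this; linarith
        · have := hnorm σ ε s (s + ε * r) hσ hε hεδ
          have hε' : (ε : ℂ) ≠ 0 := by exact_mod_cast hε.ne'
          have e : w - (c (s + ε * r) - c s) / ε
              = (c s + σ * ε * (-Complex.I * τ) - c (s + ε * r)) / ε := by
            rw [hw]; field_simp; ring
          rw [e, hnq, norm_div, Complex.norm_real, Real.norm_of_nonneg hε.le, div_pow, div_pow,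
            le_div_iff₀ (by positivity)]
          refine le_trans (le_of_eq ?_) (le_trans ?_ this)
            (b := (ε ^ 2 + ‖c (s + ε * r) - c s‖ ^ 2) / 2)
          · field_simp
          · linarith [sq_nonneg ε]
      · rw [indicator_of_notMem hr, norm_zero]
        positivity
    · exact (integrable_inv_one_add_sq.const_mul _).mul_const _
    · have hae : ∀ᵐ r : ℝ, |r| ≠ 1 := by
        have : ({1, -1} : Set ℝ).Countable := by simp
        filter_upwards [this.ae_notMem volume] with r hr h
        rcases eq_or_eq_neg_of_abs_eq h with h | h <;> simp [h] at hr
      filter_upwards [hae] with r hr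
      have hwr : w - r * deriv c s ≠ 0 := by
        intro h
        have h2 : ((-(σ * Complex.I) - r) * τ : ℂ) = 0 := by rw [← h, hw]; ring
        rcases mul_eq_zero.mp h2 with h3 | h3
        · have h5 : σ = 0 := by have := congrArg Complex.im h3; simpa using this
          simp [h5] at hσ
        · simp [h3] at hτ1
      have h1 := (hc.tendsto_jumpKernel s r hwr hr).mul
        (show Tendsto (fun ε : ℝ => (ρ (s + ε * r) : ℂ)) (𝓝[>] 0) (𝓝 (ρ s : ℂ)) from by
          have : Continuous fun ε : ℝ => (ρ (s + ε * r) : ℂ) := by fun_prop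
          simpa using (this.tendsto 0).mono_left nhdsWithin_le_nhds)
      refine h1.congr' ?_
      -- For small `ε` the point `r` lies in the rescaled interval.
      have h2 : ∀ᶠ ε : ℝ in 𝓝[>] 0, ε * |r| < L / 2 := by
        have : Continuous fun ε : ℝ => ε * |r| := by fun_prop
        have := (this.tendsto 0).mono_left (nhdsWithin_le_nhds (s := Ioi 0))
        rw [zero_mul] at this
        exact this.eventually_lt_const (by positivity)
      filter_upwards [h2, self_mem_nhdsWithin] with ε h2 (hε : 0 < ε)
      simp only [G]
      rw [indicator_of_mem]
      rw [← abs_of_pos hε, ← abs_mul, abs_lt] at h2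
      constructor
      · rw [div_lt_iff₀ hε]; linarith [h2.1]
      · rw [le_div_iff₀ hε]; linarith [h2.2]
  rw [integral_mul_const, integral_jumpKernel hτ1 hσ] at hlim
  rw [show (σ : ℂ) * Real.pi * Complex.I * ρ s / τ = σ * Real.pi * Complex.I / τ * ρ s by ring]
  refine hlim.congr' ?_
  have : ∀ᶠ ε : ℝ in 𝓝[>] 0, ε < δ := nhdsWithin_le_nhds (Iio_mem_nhds hδ)
  filter_upwards [this, self_mem_nhdsWithin] with ε hεδ (hε : 0 < ε)
  exact hGeq ε hε hεδ

end IsArcCurve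

/-! ### The logarithmic potential and the maximum principle -/

/-- The logarithmic potential `∫ log |z - c(t)| ρ(t) dt`, that is, `-2π` times the single layer
potential of the Laplace equation. -/
noncomputable def logPotential (c : ℝ → ℂ) (L : ℝ) (ρ : ℝ → ℝ) (z : ℂ) : ℝ :=
  ∫ t in (0 : ℝ)..L, Real.log ‖z - c t‖ * ρ t

/-- Near `z`, the function `w` is the real part of a holomorphic function. -/
def IsReHolomorphicAt (w : ℂ → ℝ) (z : ℂ) : Prop :=
  ∃ U : ℂ → ℂ, ∀ᶠ z' in 𝓝 z, DifferentiableAt ℂ U z' ∧ w z' = (U z').re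

lemma IsReHolomorphicAt.add {w₁ w₂ : ℂ → ℝ} {z : ℂ} (h₁ : IsReHolomorphicAt w₁ z)
    (h₂ : IsReHolomorphicAt w₂ z) : IsReHolomorphicAt (fun z => w₁ z + w₂ z) z := by
  obtain ⟨U₁, h₁⟩ := h₁
  obtain ⟨U₂, h₂⟩ := h₂
  refine ⟨fun z => U₁ z + U₂ z, ?_⟩
  filter_upwards [h₁, h₂] with z' h₁ h₂
  exact ⟨h₁.1.add h₂.1, by rw [h₁.2, h₂.2, Complex.add_re]⟩

lemma isReHolomorphicAt_log_norm_sub (a : ℝ) {z z₀ : ℂ} (h : z ≠ z₀) :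
    IsReHolomorphicAt (fun z => a * Real.log ‖z - z₀‖) z := by
  have hz : z - z₀ ≠ 0 := sub_ne_zero.mpr h
  refine ⟨fun z' => a * (Complex.log ((z' - z₀) / (z - z₀)) + Real.log ‖z - z₀‖), ?_⟩
  have hcont : ContinuousAt (fun z' : ℂ => (z' - z₀) / (z - z₀)) z := by fun_prop
  have h1 : ∀ᶠ z' in 𝓝 z, (z' - z₀) / (z - z₀) ∈ Complex.slitPlane := by
    refine hcont.eventually_mem (Complex.isOpen_slitPlane.mem_nhds ?_)
    rw [div_self hz]; exact Complex.one_mem_slitPlane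
  filter_upwards [h1] with z' h1
  refine ⟨?_, ?_⟩
  · have : DifferentiableAt ℂ (fun z' : ℂ => (z' - z₀) / (z - z₀)) z' := by fun_prop
    exact ((this.clog h1).add_const _).const_mul _
  · have h2 : (z' - z₀) ≠ 0 := fun h => by
      rw [h, zero_div] at h1; exact Complex.zero_notMem_slitPlane h1
    rw [Complex.re_ofReal_mul, Complex.add_re, Complex.log_re, norm_div,
      Real.log_div (norm_ne_zero_iff.mpr h2) (norm_ne_zero_iff.mpr hz), Complex.ofReal_re]
    ring

/-- The strong maximum principle, in local form. -/
lemma IsReHolomorphicAt.eventually_eq_of_isLocalMax {w : ℂ → ℝ} {z : ℂ}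
    (h : IsReHolomorphicAt w z) (hmax : IsLocalMax w z) : ∀ᶠ z' in 𝓝 z, w z' = w z := by
  obtain ⟨U, hU⟩ := h
  have hnorm : ∀ᶠ z' in 𝓝 z, ‖Complex.exp (U z')‖ = Real.exp (w z') := by
    filter_upwards [hU] with z' h
    rw [Complex.norm_exp, h.2]
  have h1 : IsLocalMax (norm ∘ fun z => Complex.exp (U z)) z := by
    filter_upwards [hnorm, hmax] with z' h h'
    simp only [Function.comp]
    rw [h, hnorm.self_of_nhds]
    exact Real.exp_le_exp.mpr h'
  have h2 := Complex.eventually_eq_of_isLocalMax_norm (hU.mono fun z' h => h.1.cexp) h1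
  filter_upwards [h2, hnorm] with z' h h'
  rw [h, hnorm.self_of_nhds] at h'
  exact (Real.exp_injective h').symm

/-- A nonempty compact set of complex numbers has a point outside its interior. -/
lemma exists_mem_notMem_interior {S : Set ℂ} (hS : IsCompact S) (hne : S.Nonempty) :
    ∃ z ∈ S, z ∉ interior S := by
  by_contra! h
  have hopen : IsOpen S := interior_eq_iff_isOpen.mp (interior_subset.antisymm h)
  have huniv : S = univ := IsClopen.eq_univ ⟨hS.isClosed, hopen⟩ hne
  exact noncompact_univ ℂ (huniv ▸ hS)

/-- The weak maximum principle. -/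
lemma le_of_isReHolomorphicAt_interior {K : Set ℂ} (hK : IsCompact K) {w : ℂ → ℝ}
    (hw : ContinuousOn w K) (hh : ∀ z ∈ interior K, IsReHolomorphicAt w z) {M : ℝ}
    (hM : ∀ z ∈ K, z ∉ interior K → w z ≤ M) : ∀ z ∈ K, w z ≤ M := by
  intro z hz
  obtain ⟨z₁, hz₁, hmax⟩ := hK.exists_isMaxOn ⟨z, hz⟩ hw
  have hSc : IsCompact (K ∩ w ⁻¹' {w z₁}) :=
    hK.of_isClosed_subset (hw.preimage_isClosed_of_isClosed hK.isClosed isClosed_singleton)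
      inter_subset_left
  -- The set of maximum points is compact; near one outside its interior `w` is not constant.
  obtain ⟨z₂, hz₂, hint⟩ := exists_mem_notMem_interior hSc ⟨z₁, hz₁, rfl⟩
  have heq : w z₂ = w z₁ := hz₂.2
  by_cases hi : z₂ ∈ interior K
  · refine absurd (mem_interior_iff_mem_nhds.mpr ?_) hint
    have hKn : ∀ᶠ z' in 𝓝 z₂, z' ∈ K := mem_interior_iff_mem_nhds.mp hi
    have hloc : IsLocalMax w z₂ := by
      filter_upwards [hKn] with z' hz'
      rw [heq]; exact hmax hz'
    filter_upwards [hKn, (hh z₂ hi).eventually_eq_of_isLocalMax hloc] with z' h1 h2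
    exact ⟨h1, by simp only [mem_preimage, mem_singleton_iff]; rw [h2, heq]⟩
  · exact (hmax hz).trans (heq ▸ hM z₂ hz₂.1 hi)

namespace IsArcCurve

variable {c : ℝ → ℂ} {L : ℝ} (hc : IsArcCurve c L)
include hc

lemma isCompact_range : IsCompact (range c) :=
  hc.periodic.compact_of_continuous hc.L_pos.ne' hc.continuous

variable {ρ : ℝ → ℝ}

/-- Off the curve the logarithmic potential is locally the real part of a primitive of the
Cauchy-type integral. -/
lemma exists_primitive (hρ : Continuous ρ) {z₀ : ℂ} (hz₀ : z₀ ∉ range c) :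
    ∃ U : ℂ → ℂ, ∀ᶠ z in 𝓝 z₀, HasDerivAt U (cauchyPotential c L ρ z) z ∧
      logPotential c L ρ z = (U z).re := by
  have hcc := hc.continuous
  obtain ⟨r, hr, hball⟩ := Metric.isOpen_iff.mp hc.isCompact_range.isClosed.isOpen_compl z₀ hz₀
  have hdist : ∀ t, r ≤ ‖z₀ - c t‖ := fun t => by
    by_contra! h
    exact hball (by rwa [Metric.mem_ball, dist_comm, dist_eq_norm]) ⟨t, rfl⟩
  have hne₀ : ∀ t, z₀ - c t ≠ 0 := fun t => norm_pos_iff.mp (hr.trans_le (hdist t))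
  have hfar : ∀ z ∈ Metric.ball z₀ (r / 2), ∀ t, r / 2 ≤ ‖z - c t‖ := fun z hz t => by
    have h1 := norm_sub_le_norm_sub_add_norm_sub z₀ z (c t)
    have h2 : ‖z₀ - z‖ < r / 2 := by rwa [Metric.mem_ball, dist_comm, dist_eq_norm] at hz
    linarith [hdist t]
  have hne : ∀ z ∈ Metric.ball z₀ (r / 2), ∀ t, z - c t ≠ 0 := fun z hz t =>
    norm_pos_iff.mp ((half_pos hr).trans_le (hfar z hz t))
  have hslit : ∀ z ∈ Metric.ball z₀ (r / 2), ∀ t, (z - c t) / (z₀ - c t) ∈ Complex.slitPlane := by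
    intro z hz t
    have e : (z - c t) / (z₀ - c t) = 1 + (z - z₀) / (z₀ - c t) := by
      have := hne₀ t; field_simp; ring
    rw [e]
    refine Complex.mem_slitPlane_of_norm_lt_one ?_
    rw [norm_div, div_lt_one (norm_pos_iff.mpr (hne₀ t))]
    rw [Metric.mem_ball, dist_eq_norm] at hz
    linarith [hdist t]
  have hlogc : ∀ z ∈ Metric.ball z₀ (r / 2),
      Continuous fun t => Complex.log ((z - c t) / (z₀ - c t)) * ρ t := fun z hz => by
    refine Continuous.mul (Continuous.clog ?_ (hslit z hz)) (by fun_prop)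
    exact (by fun_prop : Continuous fun t => z - c t).div (by fun_prop) hne₀
  refine ⟨fun z => (∫ t in (0 : ℝ)..L, Complex.log ((z - c t) / (z₀ - c t)) * ρ t)
    + logPotential c L ρ z₀, ?_⟩
  have hmem : Metric.ball z₀ (r / 2) ∈ 𝓝 z₀ := Metric.ball_mem_nhds _ (half_pos hr)
  filter_upwards [hmem] with z hz
  constructor
  · have hnb : Metric.ball z₀ (r / 2) ∈ 𝓝 z := Metric.isOpen_ball.mem_nhds hz
    have := (intervalIntegral.hasDerivAt_integral_of_dominated_loc_of_deriv_le (μ := volume)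
      (a := 0) (b := L)
      (F := fun z t => Complex.log ((z - c t) / (z₀ - c t)) * ρ t)
      (F' := fun z t => (ρ t : ℂ) / (z - c t)) (bound := fun t => |ρ t| / (r / 2)) hnb
      (by filter_upwards [hnb] with z' hz' using (hlogc z' hz').aestronglyMeasurable)
      ((hlogc z hz).intervalIntegrable 0 L)
      ((by fun_prop : Continuous fun t => (ρ t : ℂ)).div (by fun_prop)
        (hne z hz)).aestronglyMeasurable
      (Eventually.of_forall fun t _ z' hz' => by
        rw [norm_div, Complex.norm_real, Real.norm_eq_abs]
        gcongr
        exact hfar z' hz' t)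
      ((hρ.abs.div_const _).intervalIntegrable 0 L)
      (Eventually.of_forall fun t _ z' hz' => by
        have h1 : HasDerivAt (fun z => (z - c t) / (z₀ - c t)) (1 / (z₀ - c t)) z' :=
          ((hasDerivAt_id z').sub_const _).div_const _
        have h2 := (h1.clog (hslit z' hz' t)).mul_const (ρ t : ℂ)
        refine h2.congr_deriv ?_
        have := hne₀ t
        have := hne z' hz' t
        field_simp)).2
    simpa [cauchyPotential] using this.add_const (logPotential c L ρ z₀ : ℂ)
  · have hre : (∫ t in (0 : ℝ)..L, Complex.log ((z - c t) / (z₀ - c t)) * ρ t).re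
        = ∫ t in (0 : ℝ)..L, (Complex.log ((z - c t) / (z₀ - c t)) * ρ t).re := by
      have := Complex.reCLM.intervalIntegral_comp_comm (μ := volume)
        ((hlogc z hz).intervalIntegrable 0 L)
      simpa using this.symm
    have hcl : ∀ z, (∀ t, z - c t ≠ 0) → Continuous fun t => Real.log ‖z - c t‖ * ρ t :=
      fun z hz => (Continuous.log (by fun_prop) fun t => norm_ne_zero_iff.mpr (hz t)).mul hρ
    rw [Complex.add_re, Complex.ofReal_re, hre, logPotential, logPotential,
      ← intervalIntegral.integral_add _ ((hcl z₀ hne₀).intervalIntegrable 0 L)]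
    · refine intervalIntegral.integral_congr fun t _ => ?_
      rw [Complex.re_mul_ofReal, Complex.log_re, norm_div,
        Real.log_div (norm_ne_zero_iff.mpr (hne z hz t)) (norm_ne_zero_iff.mpr (hne₀ t))]
      ring
    · exact (Complex.continuous_re.comp (hlogc z hz)).intervalIntegrable 0 L

lemma isReHolomorphicAt_logPotential (hρ : Continuous ρ) {z : ℂ} (hz : z ∉ range c) :
    IsReHolomorphicAt (logPotential c L ρ) z := by
  obtain ⟨U, hU⟩ := hc.exists_primitive hρ hz
  exact ⟨U, hU.mono fun z' h => ⟨h.1.differentiableAt, h.2⟩⟩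

lemma hasDerivAt_logPotential_line (hρ : Continuous ρ) (a v : ℂ) {x : ℝ}
    (hx : a + x * v ∉ range c) :
    HasDerivAt (fun x : ℝ => logPotential c L ρ (a + x * v))
      (v * cauchyPotential c L ρ (a + x * v)).re x := by
  obtain ⟨U, hU⟩ := hc.exists_primitive hρ hx
  have h1 : HasDerivAt (fun x : ℝ => a + x * v) v x := by
    simpa using ((Complex.ofRealCLM.hasDerivAt (x := x)).mul_const v).const_add a
  have h2 : HasDerivAt (fun x : ℝ => U (a + x * v)) (v * cauchyPotential c L ρ (a + x * v)) x := by
    simpa [Function.comp_def] using hU.self_of_nhds.1.scomp x h1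
  have h3 := Complex.reCLM.hasFDerivAt.comp_hasDerivAt x h2
  refine HasDerivAt.congr_of_eventuallyEq (by simpa using h3) ?_
  filter_upwards [h1.continuousAt.eventually hU] with y hy
  simpa using hy.2

lemma cauchyPotential_eq_zero_of_eventually_const (hρ : Continuous ρ) {z : ℂ} {m : ℝ}
    (hz : z ∉ range c) (h : ∀ᶠ z' in 𝓝 z, logPotential c L ρ z' = m) :
    cauchyPotential c L ρ z = 0 := by
  have key : ∀ v : ℂ, (v * cauchyPotential c L ρ z).re = 0 := fun v => by
    have h1 := hc.hasDerivAt_logPotential_line hρ z v (x := 0) (by simpa using hz)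
    simp only [Complex.ofReal_zero, zero_mul, add_zero] at h1
    refine h1.unique ((hasDerivAt_const (0 : ℝ) m).congr_of_eventuallyEq ?_)
    have hcont : Tendsto (fun x : ℝ => z + x * v) (𝓝 0) (𝓝 z) := by
      have : Continuous fun x : ℝ => z + x * v := by fun_prop
      simpa using this.tendsto 0
    exact hcont.eventually h
  apply Complex.ext
  · simpa using key 1
  · simpa using key Complex.I

/-- The logarithmic potential of a continuous density is continuous across the curve. Near a point
of the curve, the integrand is dominated by a shift of `log` centred at the nearest parameter. -/
theorem continuous_logPotential (hρ : Continuous ρ) (hp : Function.Periodic ρ L) :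
    Continuous (logPotential c L ρ) := by
  rw [continuous_iff_continuousAt]
  intro z₀
  by_cases hz₀ : z₀ ∉ range c
  · obtain ⟨U, hU⟩ := hc.exists_primitive hρ hz₀
    have : ContinuousAt (fun z => (U z).re) z₀ :=
      Complex.continuous_re.continuousAt.comp hU.self_of_nhds.1.continuousAt
    exact this.congr (hU.mono fun z h => h.2.symm)
  rw [not_not] at hz₀
  obtain ⟨s₀, rfl⟩ := hz₀
  have hL := hc.L_pos
  have hcc := hc.continuous
  obtain ⟨κ, hκ, hch⟩ := hc.exists_chord_arc
  obtain ⟨M, hM⟩ := (hp.isBounded_of_continuous hL.ne' hρ).exists_norm_le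
  have hM' : ∀ t, ‖ρ t‖ ≤ M := fun t => hM _ ⟨t, rfl⟩
  have hM0 : 0 ≤ M := (norm_nonneg _).trans (hM' 0)
  obtain ⟨B₀, hB₀⟩ := hc.isCompact_range.isBounded.exists_norm_le
  have hB₀' : ∀ t, ‖c t‖ ≤ B₀ := fun t => hB₀ _ ⟨t, rfl⟩
  -- The choice of `x z` within half a period of `s₀` makes it converge to `s₀`.
  have hnearest : ∀ z : ℂ, ∃ x, |x - s₀| ≤ L / 2 ∧ ∀ t, ‖z - c x‖ ≤ ‖z - c t‖ := fun z => by
    obtain ⟨_, ⟨t, rfl⟩, ht⟩ := hc.isCompact_range.exists_isMinOn ⟨c 0, 0, rfl⟩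
      (f := fun y => ‖z - y‖) (by fun_prop)
    obtain ⟨h, hh, heq⟩ := hc.exists_near s₀ t
    exact ⟨s₀ + h, by simpa using hh, fun t' => by rw [heq]; exact ht ⟨t', rfl⟩⟩
  choose x hx hmin using hnearest
  have hxlim : Tendsto x (𝓝 (c s₀)) (𝓝 s₀) := by
    rw [tendsto_iff_norm_sub_tendsto_zero]
    have hb : ∀ z, ‖x z - s₀‖ ≤ 2 / κ * ‖z - c s₀‖ := fun z => by
      have h1 := hch s₀ (x z - s₀) (hx z)
      rw [add_sub_cancel] at h1
      have h2 := hmin z s₀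
      have h3 := norm_sub_le_norm_sub_add_norm_sub (c (x z)) z (c s₀)
      rw [norm_sub_rev (c (x z)) z] at h3
      rw [div_mul_eq_mul_div, le_div_iff₀ hκ, Real.norm_eq_abs]
      linarith
    refine squeeze_zero (fun _ => norm_nonneg _) hb ?_
    have : Continuous fun z : ℂ => 2 / κ * ‖z - c s₀‖ := by fun_prop
    simpa using this.tendsto (c s₀)
  -- By periodicity the integral may be taken over a period centred at any parameter.
  have hshift : ∀ z y, logPotential c L ρ z
      = ∫ h in (-(L / 2))..(L / 2), Real.log ‖z - c (y + h)‖ * ρ (y + h) := fun z y => by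
    have hper : Function.Periodic (fun t => Real.log ‖z - c t‖ * ρ t) L := fun t => by
      simp only [hp t, hc.periodic t]
    have e1 := hper.intervalIntegral_add_eq 0 (y - L / 2)
    rw [zero_add] at e1
    rw [logPotential, e1,
      intervalIntegral.integral_comp_add_left (fun t => Real.log ‖z - c t‖ * ρ t) y]
    congr 1; ring
  have hgoal : Tendsto (fun z => ∫ h in (-(L / 2))..(L / 2),
      Real.log ‖z - c (x z + h)‖ * ρ (x z + h)) (𝓝 (c s₀))
      (𝓝 (∫ h in (-(L / 2))..(L / 2), Real.log ‖c s₀ - c (s₀ + h)‖ * ρ (s₀ + h))) := by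
    refine intervalIntegral.tendsto_integral_filter_of_dominated_convergence
      (fun h => (|Real.log (κ / 2)| + |Real.log h| + |Real.log (2 * |B₀| + 1)|) * M) ?_ ?_ ?_ ?_
    · refine Eventually.of_forall fun z => Measurable.aestronglyMeasurable ?_
      exact (Real.measurable_log.comp (by fun_prop)).mul (by fun_prop)
    · have hnear : ∀ᶠ z in 𝓝 (c s₀), ‖z - c s₀‖ < 1 := by
        filter_upwards [Metric.ball_mem_nhds (c s₀) one_pos] with z hz
        rwa [Metric.mem_ball, dist_eq_norm] at hz
      filter_upwards [hnear] with z hz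
      have h0 : ∀ᵐ h : ℝ, h ≠ 0 := by
        simp [ae_iff]
      filter_upwards [h0] with h h0 hh
      rw [uIoc_of_le (by linarith)] at hh
      rw [norm_mul]
      refine mul_le_mul ?_ (hM' _) (norm_nonneg _) (by positivity)
      have habs : |h| ≤ L / 2 := abs_le.mpr ⟨hh.1.le, hh.2⟩
      have hlow : κ / 2 * |h| ≤ ‖z - c (x z + h)‖ := by
        have h1 := hch (x z) h habs
        have h2 := hmin z (x z + h)
        have h3 := norm_sub_le_norm_sub_add_norm_sub (c (x z + h)) z (c (x z))
        rw [norm_sub_rev (c (x z + h)) z] at h3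
        linarith
      have hupp : ‖z - c (x z + h)‖ ≤ 2 * |B₀| + 1 := by
        have h3 := norm_sub_le_norm_sub_add_norm_sub z (c s₀) (c (x z + h))
        have h4 := norm_sub_le (c s₀) (c (x z + h))
        have h5 := hB₀' s₀
        have h6 := hB₀' (x z + h)
        linarith [le_abs_self B₀]
      have hpos : 0 < κ / 2 * |h| := by positivity
      have hl1 := Real.log_le_log hpos hlow
      have hl2 := Real.log_le_log (hpos.trans_le hlow) hupp
      rw [Real.log_mul (by positivity) (by positivity), Real.log_abs] at hl1
      rw [Real.norm_eq_abs, abs_le]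
      constructor
      · linarith [neg_abs_le (Real.log (κ / 2)), neg_abs_le (Real.log h),
          abs_nonneg (Real.log (2 * |B₀| + 1))]
      · linarith [abs_nonneg (Real.log (κ / 2)), abs_nonneg (Real.log h),
          le_abs_self (Real.log (2 * |B₀| + 1))]
    · refine IntervalIntegrable.mul_const ?_ M
      exact (intervalIntegrable_const.add intervalIntegral.intervalIntegrable_log'.abs).add
        intervalIntegrable_const
    · have h0 : ∀ᵐ h : ℝ, h ≠ 0 := by
        simp [ae_iff]
      filter_upwards [h0] with h h0 hh
      rw [uIoc_of_le (by linarith)] at hh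
      have habs : |h| ≤ L / 2 := abs_le.mpr ⟨hh.1.le, hh.2⟩
      have hpos : 0 < ‖c s₀ - c (s₀ + h)‖ := by
        rw [norm_sub_rev]
        exact lt_of_lt_of_le (by positivity) (hch s₀ h habs)
      have hxh : Tendsto (fun z => x z + h) (𝓝 (c s₀)) (𝓝 (s₀ + h)) := hxlim.add_const h
      refine Tendsto.mul (Tendsto.log ?_ hpos.ne') ((hρ.tendsto _).comp hxh)
      exact (tendsto_id.sub ((hcc.tendsto _).comp hxh)).norm
  unfold ContinuousAt
  rw [hshift (c s₀) s₀]
  exact hgoal.congr fun z => (hshift z (x z)).symm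

/-- The logarithmic potential of a density of total mass zero vanishes at infinity. -/
theorem tendsto_logPotential_cocompact (hρ : Continuous ρ) (hp : Function.Periodic ρ L)
    (hzero : ∫ t in (0 : ℝ)..L, ρ t = 0) :
    Tendsto (logPotential c L ρ) (cocompact ℂ) (𝓝 0) := by
  have hL := hc.L_pos
  have hcc := hc.continuous
  obtain ⟨M, hM⟩ := (hp.isBounded_of_continuous hL.ne' hρ).exists_norm_le
  have hM' : ∀ t, ‖ρ t‖ ≤ M := fun t => hM _ ⟨t, rfl⟩
  obtain ⟨B₀, hB₀⟩ := hc.isCompact_range.isBounded.exists_norm_le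
  set B := |B₀| + 1
  have hB : ∀ t, ‖c t‖ ≤ B := fun t => (hB₀ _ ⟨t, rfl⟩).trans (by
    simp only [B]; linarith [le_abs_self B₀])
  have hBpos : 0 < B := by positivity
  have hnorm := tendsto_norm_cocompact_atTop (E := ℂ)
  have hlim : Tendsto (fun z : ℂ => 2 * B * M * |L - 0| / ‖z‖) (cocompact ℂ) (𝓝 0) :=
    hnorm.const_div_atTop _
  refine squeeze_zero_norm' ?_ hlim
  filter_upwards [hnorm.eventually_ge_atTop (2 * B)] with z hz
  have hz0 : 0 < ‖z‖ := by linarith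
  have hlow : ∀ t, ‖z‖ - B ≤ ‖z - c t‖ := fun t => by
    linarith [norm_sub_norm_le z (c t), hB t]
  have hupp : ∀ t, ‖z - c t‖ ≤ ‖z‖ + B := fun t => by
    linarith [norm_sub_le z (c t), hB t]
  have hpos : ∀ t, 0 < ‖z - c t‖ := fun t => by linarith [hlow t]
  have e : logPotential c L ρ z = ∫ t in (0 : ℝ)..L, Real.log (‖z - c t‖ / ‖z‖) * ρ t := by
    have h1 : ∫ t in (0 : ℝ)..L, Real.log ‖z‖ * ρ t = 0 := by
      rw [intervalIntegral.integral_const_mul, hzero, mul_zero]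
    have hcl : Continuous fun t => Real.log ‖z - c t‖ * ρ t :=
      (Continuous.log (by fun_prop) fun t => (hpos t).ne').mul hρ
    have hcs : Continuous fun t => Real.log ‖z‖ * ρ t := continuous_const.mul hρ
    have h2 := intervalIntegral.integral_sub (μ := volume) (hcl.intervalIntegrable 0 L)
      (hcs.intervalIntegrable 0 L)
    rw [h1, sub_zero] at h2
    rw [logPotential, ← h2]
    refine intervalIntegral.integral_congr fun t _ => ?_
    rw [Real.log_div (hpos t).ne' hz0.ne']
    ring
  rw [e]
  have hbound : ∀ t ∈ uIoc 0 L, ‖Real.log (‖z - c t‖ / ‖z‖) * ρ t‖ ≤ 2 * B / ‖z‖ * M := by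
    intro t _
    rw [norm_mul]
    refine mul_le_mul ?_ (hM' t) (norm_nonneg _) (by positivity)
    set u := ‖z - c t‖ / ‖z‖ with hu
    have hu0 : 0 < u := div_pos (hpos t) hz0
    have h1 : u ≤ 1 + B / ‖z‖ := by
      rw [hu, div_le_iff₀ hz0, add_mul, div_mul_cancel₀ _ hz0.ne']; linarith [hupp t]
    have h2 : 1 - B / ‖z‖ ≤ u := by
      rw [hu, le_div_iff₀ hz0, sub_mul, div_mul_cancel₀ _ hz0.ne']; linarith [hlow t]
    have h3 : B / ‖z‖ ≤ 1 / 2 := by rw [div_le_iff₀ hz0]; linarith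
    have h4 : 0 ≤ B / ‖z‖ := by positivity
    have h6 := Real.log_le_sub_one_of_pos hu0
    have h7 := Real.one_sub_inv_le_log_of_pos hu0
    have h8 : u⁻¹ ≤ 1 + 2 * (B / ‖z‖) := by
      rw [inv_le_iff_one_le_mul₀ hu0]
      nlinarith
    rw [Real.norm_eq_abs, abs_le, mul_div_assoc]
    constructor <;> linarith
  refine (intervalIntegral.norm_integral_le_of_norm_le_const hbound).trans (le_of_eq ?_)
  ring

end IsArcCurve

/-! ### Null densities: potential theory inside and outside the domain -/

/-- A bounded domain `D` of the complex plane bounded by the smooth simple closed curve `c`, which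
has `D` on its left: `-i c'` is the outward normal. -/
structure IsArcDomain (D : Set ℂ) (c : ℝ → ℂ) (L : ℝ) : Prop extends IsArcCurve c L where
  isOpen : IsOpen D
  isConnected : IsConnected D
  isBounded : Bornology.IsBounded D
  frontier_eq : frontier D = range c
  inner_side : ∀ s, ∀ᶠ ε : ℝ in 𝓝[>] 0, c s - ε * (-Complex.I * deriv c s) ∈ D

/-- A continuous density on the curve that is annihilated by `½ I + S_Lν`, written in the arc length
parameter and multiplied by `2π`. -/
structure IsNullDensity (c : ℝ → ℂ) (L : ℝ) (ρ : ℝ → ℝ) : Prop where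
  continuous : Continuous ρ
  periodic : Function.Periodic ρ L
  integral_eq : ∀ s, ∫ t in (0 : ℝ)..L, normalKernel c s t * ρ t = Real.pi * ρ s

lemma IsNullDensity.neg {c : ℝ → ℂ} {L : ℝ} {ρ : ℝ → ℝ} (h : IsNullDensity c L ρ) :
    IsNullDensity c L (fun t => -ρ t) where
  continuous := h.continuous.neg
  periodic t := by simp only [h.periodic t]
  integral_eq s := by
    simp only [mul_neg, intervalIntegral.integral_neg, h.integral_eq s]

namespace IsArcCurve

variable {c : ℝ → ℂ} {L : ℝ} (hc : IsArcCurve c L)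
include hc

lemma measurable_normalKernel (s : ℝ) : Measurable (normalKernel c s) := by
  have := hc.continuous
  unfold normalKernel
  exact Complex.measurable_im.comp (measurable_const.div (by fun_prop))

lemma intervalIntegrable_normalKernel_mul (s : ℝ) {ρ : ℝ → ℝ}
    (hρ : IntervalIntegrable ρ volume 0 L) :
    IntervalIntegrable (fun t => normalKernel c s t * ρ t) volume 0 L := by
  obtain ⟨C, hC, hN⟩ := hc.exists_normalKernel_le
  rw [intervalIntegrable_iff] at hρ ⊢
  exact hρ.bdd_mul (hc.measurable_normalKernel s).aestronglyMeasurable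
    (Eventually.of_forall fun t => hN s t)

/-- Since the normal kernel is bounded, its principal value integrals are plain integrals. -/
lemma tendsto_truncated_normalKernel (s : ℝ) {ρ : ℝ → ℝ}
    (hρ : IntervalIntegrable ρ volume 0 L) :
    Tendsto (fun ε : ℝ => ∫ t in (0 : ℝ)..L,
        {t | ε < ‖c s - c t‖}.indicator (fun t => normalKernel c s t * ρ t) t) (𝓝[>] 0)
      (𝓝 (∫ t in (0 : ℝ)..L, normalKernel c s t * ρ t)) := by
  have hi := hc.intervalIntegrable_normalKernel_mul s hρ
  have hcc := hc.continuous
  refine intervalIntegral.tendsto_integral_filter_of_dominated_convergence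
    (fun t => ‖normalKernel c s t * ρ t‖) ?_ ?_ hi.norm ?_
  · refine Eventually.of_forall fun ε => ?_
    rw [intervalIntegrable_iff] at hi
    exact hi.aestronglyMeasurable.indicator (measurableSet_lt measurable_const (by fun_prop))
  · exact Eventually.of_forall fun ε => Eventually.of_forall fun t _ =>
      norm_indicator_le_norm_self _ _
  · refine Eventually.of_forall fun t _ => tendsto_const_nhds.congr' ?_
    by_cases h0 : c s - c t = 0
    -- At coinciding points the kernel has the junk value `0`, like its truncations.
    · refine Eventually.of_forall fun ε => ?_
      simp [indicator, normalKernel, h0]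
    · have : ∀ᶠ ε : ℝ in 𝓝[>] 0, ε < ‖c s - c t‖ :=
        nhdsWithin_le_nhds (Iio_mem_nhds (norm_pos_iff.mpr h0))
      filter_upwards [this] with ε hε
      rw [indicator_of_mem (by exact hε)]

variable {ρ : ℝ → ℝ}

lemma im_deriv_mul_truncatedCauchy (hρ : Continuous ρ) (s : ℝ) {ε : ℝ} (hε : 0 < ε) :
    (deriv c s * truncatedCauchy c L ρ s ε).im = ∫ t in (0 : ℝ)..L,
        {t | ε < ‖c s - c t‖}.indicator (fun t => normalKernel c s t * ρ t) t := by
  rw [truncatedCauchy, ← intervalIntegral.integral_const_mul]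
  have hi := (hc.intervalIntegrable_truncated hρ s hε 0 L).const_mul (deriv c s)
  have := Complex.imCLM.intervalIntegral_comp_comm (μ := volume) hi
  simp only [Complex.imCLM_apply] at this
  rw [← this]
  refine intervalIntegral.integral_congr fun t _ => ?_
  by_cases ht : ε < ‖c s - c t‖
  · simp only [indicator, mem_ofPred_eq, if_pos ht, normalKernel]
    rw [← Complex.im_mul_ofReal]; congr 1; ring
  · simp [indicator, ht]

lemma re_deriv_mul_truncatedCauchy (hρ : Continuous ρ) (s : ℝ) {ε : ℝ} (hε : 0 < ε) :
    (deriv c s * truncatedCauchy c L ρ s ε).re = ∫ t in (0 : ℝ)..L,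
        {t | ε < ‖c s - c t‖}.indicator (fun t => (deriv c s / (c s - c t)).re * ρ t) t := by
  rw [truncatedCauchy, ← intervalIntegral.integral_const_mul]
  have hi := (hc.intervalIntegrable_truncated hρ s hε 0 L).const_mul (deriv c s)
  have := Complex.reCLM.intervalIntegral_comp_comm (μ := volume) hi
  simp only [Complex.reCLM_apply] at this
  rw [← this]
  refine intervalIntegral.integral_congr fun t _ => ?_
  by_cases ht : ε < ‖c s - c t‖
  · simp only [indicator, mem_ofPred_eq, if_pos ht]
    rw [← Complex.re_mul_ofReal]; congr 1; ring
  · simp [indicator, ht]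

/-- Jump relation for the normal derivative of the logarithmic potential. -/
lemma tendsto_normal_deriv (hρ : Continuous ρ) (hp : Function.Periodic ρ L) (s : ℝ) {σ : ℝ}
    (hσ : σ ^ 2 = 1) :
    Tendsto (fun ε : ℝ => (-Complex.I * deriv c s *
        cauchyPotential c L ρ (c s + σ * ε * (-Complex.I * deriv c s))).re) (𝓝[>] 0)
      (𝓝 ((∫ t in (0 : ℝ)..L, normalKernel c s t * ρ t) + σ * Real.pi * ρ s)) := by
  have h1 := hc.tendsto_truncated_normalKernel s (hρ.intervalIntegrable 0 L)
  have h2 := hc.tendsto_cauchyPotential_sub_truncatedCauchy hρ hp s hσ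
  have h3 := (Complex.continuous_re.tendsto _).comp (h2.const_mul (-Complex.I * deriv c s))
  have hv : (-Complex.I * deriv c s * (σ * Real.pi * Complex.I * ρ s / deriv c s)).re
      = σ * Real.pi * ρ s := by
    have : -Complex.I * deriv c s * (σ * Real.pi * Complex.I * ρ s / deriv c s)
        = ((σ * Real.pi * ρ s : ℝ) : ℂ) := by
      have := hc.deriv_ne_zero s
      field_simp
      rw [Complex.I_sq]; push_cast; ring
    rw [this, Complex.ofReal_re]
  rw [hv] at h3
  refine (h1.add h3).congr' ?_
  filter_upwards [self_mem_nhdsWithin] with ε (hε : 0 < ε)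
  rw [← hc.im_deriv_mul_truncatedCauchy hρ s hε]
  simp only [Function.comp, Complex.mul_re, Complex.mul_im, Complex.neg_re, Complex.neg_im,
    Complex.I_re, Complex.I_im, Complex.sub_re, Complex.sub_im]
  ring

lemma eventually_normal_notMem_range (s : ℝ) {σ : ℝ} (hσ : σ ^ 2 = 1) :
    ∀ᶠ ε : ℝ in 𝓝[>] 0, c s + σ * ε * (-Complex.I * deriv c s) ∉ range c := by
  obtain ⟨δ, hδ, h⟩ := hc.exists_normal_estimate
  have : ∀ᶠ ε : ℝ in 𝓝[>] 0, ε < δ := nhdsWithin_le_nhds (Iio_mem_nhds hδ)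
  filter_upwards [this, self_mem_nhdsWithin] with ε hεδ (hε : 0 < ε)
  rintro ⟨t, ht⟩
  have := h σ ε s t hσ hε hεδ
  rw [← ht, sub_self, norm_zero] at this
  nlinarith [sq_nonneg ‖c t - c s‖, pow_pos hε 2]

/-- One-sided normal derivatives of the logarithmic potential on the curve. -/
lemma hasDerivWithinAt_normal (hρ : Continuous ρ) (hp : Function.Periodic ρ L) (s : ℝ) {σ : ℝ}
    (hσ : σ ^ 2 = 1) :
    HasDerivWithinAt
      (fun ε : ℝ => logPotential c L ρ (c s + ε * (σ * (-Complex.I * deriv c s))))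
      (σ * (∫ t in (0 : ℝ)..L, normalKernel c s t * ρ t) + Real.pi * ρ s) (Ici 0) 0 := by
  set v : ℂ := σ * (-Complex.I * deriv c s) with hv
  have hev := hc.eventually_normal_notMem_range s hσ
  have hcont := hc.continuous_logPotential hρ hp
  have hrw : ∀ ε : ℝ, c s + σ * ε * (-Complex.I * deriv c s) = c s + ε * v := fun ε => by
    rw [hv]; ring
  simp only [hrw] at hev
  refine hasDerivWithinAt_Ici_of_tendsto_deriv
    (s := {ε : ℝ | c s + ε * v ∉ range c}) ?_ ?_ hev ?_
  · intro ε hε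
    exact (hc.hasDerivAt_logPotential_line hρ (c s) v hε).differentiableAt.differentiableWithinAt
  · exact (by fun_prop :
      Continuous fun ε : ℝ => logPotential c L ρ (c s + ε * v)).continuousWithinAt
  · have h1 := (hc.tendsto_normal_deriv hρ hp s hσ).const_mul σ
    have hσ' : σ * ((∫ t in (0 : ℝ)..L, normalKernel c s t * ρ t) + σ * Real.pi * ρ s)
        = σ * (∫ t in (0 : ℝ)..L, normalKernel c s t * ρ t) + Real.pi * ρ s := by
      linear_combination (Real.pi * ρ s) * hσ
    rw [hσ'] at h1
    refine h1.congr' ?_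
    filter_upwards [hev] with ε hε
    rw [(hc.hasDerivAt_logPotential_line hρ (c s) v hε).deriv, hrw, hv, mul_assoc (σ : ℂ),
      Complex.re_ofReal_mul]

/-- A null density of total mass zero whose potential takes a nonnegative constant value on the
curve is nonpositive: the potential is largest on the curve. -/
lemma nonpos_of_logPotential_eq_const (hρ : IsNullDensity c L ρ)
    (hzero : ∫ t in (0 : ℝ)..L, ρ t = 0) {m : ℝ} (hm : 0 ≤ m)
    (hconst : ∀ t, logPotential c L ρ (c t) = m) (s : ℝ) : ρ s ≤ 0 := by
  have hcont := hc.continuous_logPotential hρ.continuous hρ.periodic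
  have hinf := hc.tendsto_logPotential_cocompact hρ.continuous hρ.periodic hzero
  have hle : ∀ z, logPotential c L ρ z ≤ m := by
    by_contra! h
    obtain ⟨z₀, hz₀⟩ := h
    obtain ⟨z₁, hz₁⟩ := hcont.exists_forall_ge' z₀
      (hinf.eventually_le_const (hm.trans_lt hz₀))
    have hm₁ : m < logPotential c L ρ z₁ := hz₀.trans_le (hz₁ z₀)
    have hcl : IsClosed {z | logPotential c L ρ z₁ ≤ logPotential c L ρ z} :=
      isClosed_le continuous_const hcont
    have hcpt : IsCompact {z | logPotential c L ρ z₁ ≤ logPotential c L ρ z} := by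
      obtain ⟨K, hK, hKsub⟩ := mem_cocompact.mp
        (hinf.eventually_lt_const (hm.trans_lt hm₁))
      refine hK.of_isClosed_subset hcl fun z hz => ?_
      by_contra hzK
      exact absurd (show logPotential c L ρ z < logPotential c L ρ z₁ from hKsub hzK)
        (not_lt.mpr hz)
    obtain ⟨z₂, hz₂, hint⟩ := exists_mem_notMem_interior hcpt ⟨z₁, le_refl (logPotential c L ρ z₁)⟩
    have hz₂' : logPotential c L ρ z₁ ≤ logPotential c L ρ z₂ := hz₂
    have hoff : z₂ ∉ range c := by
      rintro ⟨t, rfl⟩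
      rw [hconst] at hz₂'; linarith
    refine hint (mem_interior_iff_mem_nhds.mpr ?_)
    have hloc : IsLocalMax (logPotential c L ρ) z₂ :=
      Eventually.of_forall fun z => (hz₁ z).trans hz₂'
    filter_upwards [(hc.isReHolomorphicAt_logPotential hρ.continuous
      hoff).eventually_eq_of_isLocalMax hloc] with z hz
    exact hz₂'.trans_eq hz.symm
  have hd := hc.hasDerivWithinAt_normal hρ.continuous hρ.periodic s (σ := 1) (by norm_num)
  rw [hρ.integral_eq s, hasDerivWithinAt_iff_tendsto_slope] at hd
  have hd' := hd.mono_left (nhdsWithin_mono 0 (t := Ici 0 \ {0}) (s := Ioi 0)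
    fun x (hx : 0 < x) => ⟨hx.le, hx.ne'⟩)
  have : 1 * (Real.pi * ρ s) + Real.pi * ρ s ≤ 0 := by
    refine le_of_tendsto hd' ?_
    filter_upwards [self_mem_nhdsWithin] with ε (hε : 0 < ε)
    rw [slope_def_field]
    refine div_nonpos_of_nonpos_of_nonneg ?_ (by linarith)
    simp only [Complex.ofReal_zero, zero_mul, add_zero, hconst s]
    linarith [hle (c s + ε * ((1 : ℝ) * (-Complex.I * deriv c s)))]
  nlinarith [Real.pi_pos]

end IsArcCurve

namespace IsArcDomain

variable {D : Set ℂ} {c : ℝ → ℂ} {L : ℝ} (hD : IsArcDomain D c L)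
include hD

lemma isCompact_closure : IsCompact (closure D) := hD.isBounded.isCompact_closure

lemma notMem_range {z : ℂ} (hz : z ∈ D) : z ∉ range c := by
  rw [← hD.frontier_eq]
  exact fun h => (hD.isOpen.frontier_eq ▸ h).2 hz

/-- The interior ball condition. -/
lemma exists_inner_ball (s : ℝ) : ∃ R : ℝ, 0 < R ∧
    Metric.ball (c s - R * (-Complex.I * deriv c s)) R ⊆ D := by
  obtain ⟨δ, hδ, h⟩ := hD.exists_normal_estimate
  refine ⟨δ / 2, by positivity, ?_⟩
  set R := δ / 2 with hR
  have hR0 : 0 < R := by positivity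
  set n := -Complex.I * deriv c s with hn
  have hn1 : ‖n‖ = 1 := by simp [hn, hD.norm_deriv]
  have hdisj : ∀ t, R ≤ ‖c s - R * n - c t‖ := fun t => by
    have h1 := h (-1) R s t (by norm_num) hR0 (by linarith)
    rw [show c s + ((-1 : ℝ) : ℂ) * R * n - c t = c s - R * n - c t by push_cast; ring] at h1
    exact le_of_sq_le_sq (by nlinarith [sq_nonneg ‖c t - c s‖]) (norm_nonneg _)
  by_contra hsub
  obtain ⟨y, hy, hyD⟩ := not_subset.mp hsub
  have hmem : ∃ x, x ∈ Metric.ball (c s - R * n) R ∩ D := by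
    have h2 : ∀ᶠ ε : ℝ in 𝓝[>] 0, ε < R := nhdsWithin_le_nhds (Iio_mem_nhds hR0)
    obtain ⟨ε, hε1, hε2, hε3⟩ := ((hD.inner_side s).and (h2.and self_mem_nhdsWithin)).exists
    refine ⟨_, ?_, hε1⟩
    have hε3' : 0 < ε := hε3
    rw [Metric.mem_ball, dist_eq_norm,
      show c s - ε * n - (c s - R * n) = ((R - ε : ℝ) : ℂ) * n by push_cast; ring,
      norm_mul, hn1, mul_one, Complex.norm_real, Real.norm_eq_abs, abs_of_pos (by linarith)]
    linarith
  have hcover : ∀ z ∈ Metric.ball (c s - R * n) R, z ∈ D ∨ z ∈ (closure D)ᶜ := by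
    intro z hz
    by_contra! h
    obtain ⟨t, rfl⟩ : z ∈ range c := by
      rw [← hD.frontier_eq, hD.isOpen.frontier_eq]
      exact ⟨not_not.mp h.2, h.1⟩
    rw [Metric.mem_ball, dist_comm, dist_eq_norm] at hz
    exact absurd (hdisj t) (not_le.mpr hz)
  obtain ⟨z, -, hz1, hz2⟩ := (convex_ball (c s - R * n) R).isPreconnected _ _ hD.isOpen
    isClosed_closure.isOpen_compl hcover hmem ⟨y, hy, (hcover y hy).resolve_left hyD⟩
  exact hz2 (subset_closure hz1)

variable {ρ : ℝ → ℝ}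

/-- The potential of a null density is constant inside: its interior normal derivative vanishes, so
by Hopf's boundary lemma it cannot have a strict maximum over the closure on the boundary. The
comparison function for Hopf's lemma is the logarithm on an annulus in the interior ball. -/
theorem exists_logPotential_eq_const (hρ : IsNullDensity c L ρ) :
    ∃ m, ∀ z ∈ closure D, logPotential c L ρ z = m := by
  have hc := hD.toIsArcCurve
  have hcont := hc.continuous_logPotential hρ.continuous hρ.periodic
  set p := logPotential c L ρ with hp
  obtain ⟨x, hxD, hmax⟩ := hD.isCompact_closure.exists_isMaxOn hD.isConnected.nonempty.closure
    hcont.continuousOn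
  have hle : ∀ z ∈ closure D, p z ≤ p x := fun z hz => hmax hz
  suffices hall : ∀ z ∈ D, p z = p x by
    refine ⟨p x, fun z hz => ?_⟩
    exact closure_minimal (s := D) (t := {z | p z = p x}) hall
      (isClosed_eq hcont continuous_const) hz
  by_contra! hne
  obtain ⟨z₀, hz₀D, hz₀⟩ := hne
  -- By the strong maximum principle the maximum is not attained in the connected set `D`.
  have hlt : ∀ z ∈ D, p z < p x := by
    intro z hz
    refine lt_of_le_of_ne (hle z (subset_closure hz)) fun heq => ?_
    have hopen : IsOpen {z | z ∈ D ∧ p z = p x} := by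
      rw [isOpen_iff_mem_nhds]
      rintro y ⟨hyD, hy⟩
      have hloc : IsLocalMax p y := by
        filter_upwards [hD.isOpen.mem_nhds hyD] with y' hy'
        rw [hy]; exact hle y' (subset_closure hy')
      filter_upwards [hD.isOpen.mem_nhds hyD, (hc.isReHolomorphicAt_logPotential hρ.continuous
        (hD.notMem_range hyD)).eventually_eq_of_isLocalMax hloc] with y' h1 h2
      exact ⟨h1, h2.trans hy⟩
    have hopen' : IsOpen {z | p z ≠ p x} := isOpen_ne_fun hcont continuous_const
    obtain ⟨y, -, hy1, hy2⟩ := hD.isConnected.isPreconnected _ _ hopen hopen'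
      (fun y hy => by
        by_cases h : p y = p x
        · exact Or.inl ⟨hy, h⟩
        · exact Or.inr h)
      ⟨z, hz, hz, heq⟩ ⟨z₀, hz₀D, hz₀⟩
    exact hy2 hy1.2
  have hxΓ : x ∈ range c := by
    rw [← hD.frontier_eq, hD.isOpen.frontier_eq]
    exact ⟨hxD, fun h => (hlt x h).ne rfl⟩
  obtain ⟨s, rfl⟩ := hxΓ
  obtain ⟨R, hR, hball⟩ := hD.exists_inner_ball s
  set n := -Complex.I * deriv c s with hn
  have hn1 : ‖n‖ = 1 := by simp [hn, hD.norm_deriv]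
  set a := c s - R * n with ha
  have hcball : Metric.closedBall a R ⊆ closure D := by
    rw [← closure_ball a hR.ne']; exact closure_mono hball
  obtain ⟨y, hy, hymax⟩ := (isCompact_closedBall a (R / 2)).exists_isMaxOn
    ⟨a, Metric.mem_closedBall_self (by positivity)⟩ hcont.continuousOn
  have hsub : Metric.closedBall a (R / 2) ⊆ D :=
    (Metric.closedBall_subset_ball (by linarith)).trans hball
  have hη : 0 < p (c s) - p y := sub_pos.mpr (hlt y (hsub hy))
  set δ := (p (c s) - p y) / Real.log 2 with hδdef
  have hlog2 : 0 < Real.log 2 := Real.log_pos one_lt_two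
  have hδ : 0 < δ := div_pos hη hlog2
  have hannulus : ∀ z ∈ Metric.closedBall a R \ Metric.ball a (R / 2),
      p z + -δ * Real.log ‖z - a‖ ≤ p (c s) - δ * Real.log R := by
    have hne : ∀ z ∈ Metric.closedBall a R \ Metric.ball a (R / 2), z ≠ a := by
      rintro z ⟨-, hz⟩ rfl
      exact hz (Metric.mem_ball_self (by positivity))
    refine le_of_isReHolomorphicAt_interior
      ((isCompact_closedBall a R).diff Metric.isOpen_ball) ?_ ?_ ?_
    · refine hcont.continuousOn.add (continuousOn_const.mul ?_)
      exact ContinuousOn.log (by fun_prop)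
        fun z hz => norm_ne_zero_iff.mpr (sub_ne_zero.mpr (hne z hz))
    · intro z hz
      have h1 : z ∈ interior (Metric.closedBall a R) := interior_mono sdiff_subset hz
      rw [interior_closedBall a hR.ne'] at h1
      exact (hc.isReHolomorphicAt_logPotential hρ.continuous (hD.notMem_range (hball h1))).add
        (isReHolomorphicAt_log_norm_sub (-δ) (hne z (interior_subset hz)))
    · rintro z ⟨hz1, hz2⟩ hint
      have hz1' : ‖z - a‖ ≤ R := by rwa [Metric.mem_closedBall, dist_eq_norm] at hz1
      have hz2' : R / 2 ≤ ‖z - a‖ := by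
        rwa [Metric.mem_ball, dist_eq_norm, not_lt] at hz2
      rcases hz1'.eq_or_lt with h | h
      · rw [h]; linarith [hle z (hcball hz1)]
      rcases hz2'.eq_or_lt with h' | h'
      · have h3 : p z ≤ p y := hymax (by
          simp only [Metric.mem_closedBall]; rw [dist_eq_norm, ← h'])
        rw [← h', Real.log_div hR.ne' two_ne_zero]
        have : δ * Real.log 2 = p (c s) - p y := div_mul_cancel₀ _ hlog2.ne'
        linarith
      · refine absurd (mem_interior_iff_mem_nhds.mpr ?_) hint
        have hcn : ContinuousAt (fun z : ℂ => ‖z - a‖) z := by fun_prop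
        filter_upwards [hcn.eventually_lt_const h, hcn.eventually_const_lt h'] with z' h1 h2
        refine ⟨?_, ?_⟩
        · rw [Metric.mem_closedBall, dist_eq_norm]; exact h1.le
        · rw [Metric.mem_ball, dist_eq_norm, not_lt]; exact h2.le
  have hd := hc.hasDerivWithinAt_normal hρ.continuous hρ.periodic s (σ := -1) (by norm_num)
  rw [hρ.integral_eq s, hasDerivWithinAt_iff_tendsto_slope] at hd
  have hd' := hd.mono_left (nhdsWithin_mono 0 (t := Ici 0 \ {0}) (s := Ioi 0)
    fun x (hx : 0 < x) => ⟨hx.le, hx.ne'⟩)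
  -- The interior normal derivative vanishes, but the comparison bounds it away from zero.
  have hcontra : -1 * (Real.pi * ρ s) + Real.pi * ρ s ≤ -(δ / R) := by
    refine le_of_tendsto hd' ?_
    have h2 : ∀ᶠ ε : ℝ in 𝓝[>] 0, ε < R / 2 := nhdsWithin_le_nhds (Iio_mem_nhds (half_pos hR))
    filter_upwards [self_mem_nhdsWithin, h2] with ε (hε : 0 < ε) hεR
    rw [slope_def_field, sub_zero, div_le_iff₀ hε]
    simp only [Complex.ofReal_zero, zero_mul, add_zero]
    have e : c s + (ε : ℂ) * (((-1 : ℝ) : ℂ) * n) - a = ((R - ε : ℝ) : ℂ) * n := by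
      rw [ha]; push_cast; ring
    have enorm : ‖c s + (ε : ℂ) * (((-1 : ℝ) : ℂ) * n) - a‖ = R - ε := by
      rw [e, norm_mul, hn1, mul_one, Complex.norm_real, Real.norm_eq_abs, abs_of_pos (by linarith)]
    have h3 := hannulus (c s + (ε : ℂ) * (((-1 : ℝ) : ℂ) * n)) (by
      constructor
      · rw [Metric.mem_closedBall, dist_eq_norm, enorm]; linarith
      · rw [Metric.mem_ball, dist_eq_norm, enorm]; linarith)
    rw [enorm] at h3
    have h4 : Real.log (R - ε) - Real.log R ≤ -(ε / R) := by
      rw [← Real.log_div (by linarith) hR.ne']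
      have := Real.log_le_sub_one_of_pos (x := (R - ε) / R) (div_pos (by linarith) hR)
      refine this.trans (le_of_eq ?_)
      field_simp; ring
    have h5 : δ * (Real.log (R - ε) - Real.log R) ≤ δ * -(ε / R) := by gcongr
    have h6 : -(δ / R) * ε = δ * -(ε / R) := by ring
    rw [h6]
    linarith
  have : 0 < δ / R := div_pos hδ hR
  linarith

/-- A null density of total mass zero vanishes. -/
theorem eq_zero_of_integral_eq_zero (hρ : IsNullDensity c L ρ)
    (hzero : ∫ t in (0 : ℝ)..L, ρ t = 0) : ρ = 0 := by
  have hc := hD.toIsArcCurve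
  obtain ⟨m, hm⟩ := hD.exists_logPotential_eq_const hρ
  have hΓ : ∀ t, logPotential c L ρ (c t) = m := fun t => hm _ (by
    have : c t ∈ frontier D := by rw [hD.frontier_eq]; exact ⟨t, rfl⟩
    exact frontier_subset_closure this)
  have hsign : (∀ s, ρ s ≤ 0) ∨ (∀ s, 0 ≤ ρ s) := by
    rcases le_total 0 m with h | h
    · exact Or.inl (hc.nonpos_of_logPotential_eq_const hρ hzero h hΓ)
    · right
      intro s
      have := hc.nonpos_of_logPotential_eq_const hρ.neg (by simp [hzero]) (m := -m)
        (by linarith) (fun t => by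
          have := hΓ t
          simp only [logPotential, mul_neg, intervalIntegral.integral_neg] at this ⊢
          rw [this]) s
      linarith
  have hz : ∀ f : ℝ → ℝ, Continuous f → Function.Periodic f L → (∀ s, 0 ≤ f s) →
      ∫ t in (0 : ℝ)..L, f t = 0 → f = 0 := by
    intro f hf hfp hf0 hint
    by_contra hne
    obtain ⟨s, hs⟩ := Function.ne_iff.mp hne
    have h1 := hfp.intervalIntegral_add_eq 0 s
    rw [zero_add, hint] at h1
    have h2 : 0 < ∫ t in s..(s + L), f t :=
      intervalIntegral.integral_pos (by linarith [hc.L_pos]) hf.continuousOn (fun x _ => hf0 x)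
        ⟨s, ⟨le_refl _, by linarith [hc.L_pos]⟩, lt_of_le_of_ne (hf0 s) (Ne.symm hs)⟩
    linarith
  rcases hsign with h | h
  · have := hz (fun t => -ρ t) hρ.continuous.neg hρ.neg.periodic (fun s => by linarith [h s])
      (by simp [hzero])
    ext s
    simpa using congrFun this s
  · exact hz ρ hρ.continuous hρ.periodic h hzero

/-- The principal value of the tangential derivative of the potential of a null density vanishes. -/
theorem tendsto_tangential (hρ : IsNullDensity c L ρ) (s : ℝ) :
    Tendsto (fun ε : ℝ => ∫ t in (0 : ℝ)..L,
        {t | ε < ‖c s - c t‖}.indicator (fun t => (deriv c s / (c s - c t)).re * ρ t) t)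
      (𝓝[>] 0) (𝓝 0) := by
  have hc := hD.toIsArcCurve
  obtain ⟨m, hm⟩ := hD.exists_logPotential_eq_const hρ
  have h2 := hc.tendsto_cauchyPotential_sub_truncatedCauchy hρ.continuous hρ.periodic s
    (σ := -1) (by norm_num)
  have h3 := (Complex.continuous_re.tendsto _).comp (h2.const_mul (-deriv c s))
  have hv : (-deriv c s * (((-1 : ℝ) : ℂ) * Real.pi * Complex.I * ρ s / deriv c s)).re = 0 := by
    have : -deriv c s * (((-1 : ℝ) : ℂ) * Real.pi * Complex.I * ρ s / deriv c s)
        = ((Real.pi * ρ s : ℝ) : ℂ) * Complex.I := by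
      have := hc.deriv_ne_zero s
      field_simp
      push_cast; ring
    rw [this, Complex.re_ofReal_mul, Complex.I_re, mul_zero]
  rw [hv] at h3
  refine h3.congr' ?_
  filter_upwards [self_mem_nhdsWithin, hD.inner_side s] with ε (hε : 0 < ε) hin
  rw [← hc.re_deriv_mul_truncatedCauchy hρ.continuous s hε]
  have hF : cauchyPotential c L ρ (c s + ((-1 : ℝ) : ℂ) * ε * (-Complex.I * deriv c s)) = 0 := by
    rw [show c s + ((-1 : ℝ) : ℂ) * ε * (-Complex.I * deriv c s)
      = c s - ε * (-Complex.I * deriv c s) by push_cast; ring]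
    refine hc.cauchyPotential_eq_zero_of_eventually_const hρ.continuous (m := m)
      (hD.notMem_range hin) ?_
    filter_upwards [hD.isOpen.mem_nhds hin] with z hz
    exact hm z (subset_closure hz)
  simp only [Function.comp, hF, zero_sub, neg_mul_neg]

end IsArcDomain

/-! ### Gauss' formula for the subtended angle -/

lemma uIcc_add_sub_subset_Ioo {t L ε : ℝ} (hε : 0 < ε) (hεL : ε < L / 2) :
    uIcc (t + ε) (t + L - ε) ⊆ Ioo t (t + L) := by
  rw [uIcc_of_le (by linarith)]
  exact fun x hx => ⟨by linarith [hx.1], by linarith [hx.2]⟩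

namespace IsArcCurve

variable {c : ℝ → ℂ} {L : ℝ} (hc : IsArcCurve c L)
include hc

lemma ae_ne (t : ℝ) : ∀ᵐ s : ℝ, c s ≠ c t := by
  have hcount : (range fun k : ℤ => t + k * L).Countable := countable_range _
  filter_upwards [hcount.ae_notMem volume] with s hs h
  obtain ⟨k, hk⟩ := hc.eq_of_apply_eq h
  exact hs ⟨k, hk.symm⟩

lemma sub_ne_zero_of_mem_Ioo {s t : ℝ} (hs : s ∈ Ioo t (t + L)) : c s - c t ≠ 0 := by
  intro h
  obtain ⟨k, hk⟩ := hc.eq_of_apply_eq (sub_eq_zero.mp h)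
  have hL := hc.L_pos
  have h1 : (0 : ℝ) < k := by
    have := hs.1; rw [hk] at this
    by_contra hneg
    nlinarith [not_lt.mp hneg]
  have h2 : (k : ℝ) < 1 := by
    have := hs.2; rw [hk] at this
    by_contra hneg
    nlinarith [not_lt.mp hneg]
  have h1' : 0 < k := by exact_mod_cast h1
  have h2' : k < 1 := by exact_mod_cast h2
  omega

lemma measurable_normalKernel_uncurry : Measurable fun p : ℝ × ℝ => normalKernel c p.1 p.2 := by
  have := hc.continuous
  have := hc.continuous_deriv
  unfold normalKernel
  exact Complex.measurable_im.comp
    ((by fun_prop : Measurable fun p : ℝ × ℝ => deriv c p.1).div (by fun_prop))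

lemma measurable_normalKernel_left (t : ℝ) : Measurable fun s => normalKernel c s t :=
  hc.measurable_normalKernel_uncurry.comp (measurable_id.prodMk measurable_const)

lemma continuousAt_normalKernel_left {s t : ℝ} (h : c s ≠ c t) :
    ContinuousAt (fun s => normalKernel c s t) s := by
  have h1 := hc.continuous
  have h2 := hc.continuous_deriv
  exact Complex.continuous_im.continuousAt.comp
    (h2.continuousAt.div (by fun_prop) (sub_ne_zero.mpr h))

lemma continuousAt_normalKernel_right {s t : ℝ} (h : c s ≠ c t) :
    ContinuousAt (fun t => normalKernel c s t) t := by
  have h1 := hc.continuous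
  exact Complex.continuous_im.continuousAt.comp
    (continuousAt_const.div (by fun_prop) (sub_ne_zero.mpr h))

lemma intervalIntegrable_normalKernel_left (t a b : ℝ) :
    IntervalIntegrable (fun s => normalKernel c s t) volume a b := by
  obtain ⟨C, hC, hN⟩ := hc.exists_normalKernel_le
  exact (intervalIntegrable_const (c := C)).mono_fun
    (hc.measurable_normalKernel_left t).aestronglyMeasurable
    (Eventually.of_forall fun s => (hN s t).trans (le_abs_self C))

lemma continuous_integral_normalKernel_left :
    Continuous fun t => ∫ s in (0 : ℝ)..L, normalKernel c s t := by
  obtain ⟨C, hC, hN⟩ := hc.exists_normalKernel_le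
  rw [continuous_iff_continuousAt]
  intro t
  refine intervalIntegral.continuousAt_of_dominated_interval (bound := fun _ => C) ?_ ?_
    intervalIntegrable_const ?_
  · exact Eventually.of_forall fun t => (hc.measurable_normalKernel_left t).aestronglyMeasurable
  · exact Eventually.of_forall fun t => Eventually.of_forall fun s _ => hN s t
  · filter_upwards [hc.ae_ne t] with s hs _
    exact hc.continuousAt_normalKernel_right hs

lemma integral_normalKernel_left_eq (t : ℝ) :
    ∫ s in (0 : ℝ)..L, normalKernel c s t = ∫ s in t..(t + L), normalKernel c s t := by
  have hper : Function.Periodic (fun s => normalKernel c s t) L := fun s => by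
    simp only [normalKernel, hc.periodic s, hc.deriv_periodic s]
  have := hper.intervalIntegral_add_eq 0 t
  rwa [zero_add] at this

lemma tendsto_integral_normalKernel_left (t : ℝ) :
    Tendsto (fun ε : ℝ => ∫ s in (t + ε)..(t + L - ε), normalKernel c s t) (𝓝[>] 0)
      (𝓝 (∫ s in (0 : ℝ)..L, normalKernel c s t)) := by
  rw [hc.integral_normalKernel_left_eq t]
  have hi := hc.intervalIntegrable_normalKernel_left t
  have hP := intervalIntegral.continuous_primitive hi t
  have hcont : Continuous fun ε : ℝ => (∫ s in t..(t + L - ε), normalKernel c s t)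
      - ∫ s in t..(t + ε), normalKernel c s t :=
    (hP.comp (by fun_prop : Continuous fun ε : ℝ => t + L - ε)).sub
      (hP.comp (by fun_prop : Continuous fun ε : ℝ => t + ε))
  have h0 := (hcont.tendsto 0).mono_left (nhdsWithin_le_nhds (s := Ioi 0))
  simp only [sub_zero, add_zero, intervalIntegral.integral_same] at h0
  refine h0.congr fun ε => ?_
  rw [← intervalIntegral.integral_add_adjacent_intervals (hi t (t + ε)) (hi (t + ε) (t + L - ε))]
  ring

lemma continuousOn_logDeriv_chord (t : ℝ) :
    ContinuousOn (fun s => deriv c s / (c s - c t)) (Ioo t (t + L)) := by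
  have h1 := hc.continuous
  have h2 := hc.continuous_deriv
  exact h2.continuousOn.div (by fun_prop) fun s hs => hc.sub_ne_zero_of_mem_Ioo hs

lemma integral_normalKernel_eq_im {t a b : ℝ} (hab : uIcc a b ⊆ Ioo t (t + L)) :
    ∫ s in a..b, normalKernel c s t = (∫ s in a..b, deriv c s / (c s - c t)).im := by
  have hi := ((hc.continuousOn_logDeriv_chord t).mono hab).intervalIntegrable (μ := volume)
  simpa [normalKernel] using Complex.imCLM.intervalIntegral_comp_comm (μ := volume) hi

/-- The logarithmic derivative of the chord integrates to a logarithm of the quotient of the extreme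
chords. -/
lemma exp_integral_logDeriv_chord {t ε : ℝ} (hε : 0 < ε) (hεL : ε < L / 2) :
    Complex.exp (∫ s in (t + ε)..(t + L - ε), deriv c s / (c s - c t))
      = (c (t + L - ε) - c t) / (c (t + ε) - c t) := by
  set k : ℝ → ℂ := fun s => deriv c s / (c s - c t) with hk
  have hsub := uIcc_add_sub_subset_Ioo (t := t) hε hεL
  rw [uIcc_of_le (by linarith)] at hsub
  have hkm : Measurable k := by
    have := hc.continuous
    have := hc.continuous_deriv
    exact (by fun_prop : Measurable (deriv c)).div (by fun_prop)
  have hderiv : ∀ x ∈ Icc (t + ε) (t + L - ε),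
      HasDerivAt (fun x => Complex.exp (-∫ s in (t + ε)..x, k s) * (c x - c t)) 0 x := by
    intro x hx
    have hki : IntervalIntegrable k volume (t + ε) x := by
      refine ((hc.continuousOn_logDeriv_chord t).mono fun y hy => hsub ?_).intervalIntegrable
      rw [uIcc_of_le hx.1] at hy
      exact ⟨hy.1, hy.2.trans hx.2⟩
    have h1 := intervalIntegral.integral_hasDerivAt_right hki
      hkm.stronglyMeasurable.stronglyMeasurableAtFilter
      ((hc.continuousOn_logDeriv_chord t).continuousAt (isOpen_Ioo.mem_nhds (hsub hx)))
    have h2 := h1.neg.cexp.mul ((hc.hasDerivAt x).sub_const (c t))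
    refine h2.congr_deriv ?_
    have h3 := hc.sub_ne_zero_of_mem_Ioo (hsub hx)
    simp only [hk]
    field_simp
    ring
  have hconst := constant_of_has_deriv_right_zero
    (fun x hx => (hderiv x hx).continuousAt.continuousWithinAt)
    (fun x hx => (hderiv x (Ico_subset_Icc_self hx)).hasDerivWithinAt)
    (t + L - ε) ⟨by linarith, le_refl _⟩
  simp only [intervalIntegral.integral_same, neg_zero, Complex.exp_zero, one_mul] at hconst
  have h0 : c (t + ε) - c t ≠ 0 := hc.sub_ne_zero_of_mem_Ioo (hsub ⟨le_refl _, by linarith⟩)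
  rw [← hconst, Complex.exp_neg]
  have h1 := hc.sub_ne_zero_of_mem_Ioo (hsub ⟨by linarith, le_refl (t + L - ε)⟩)
  field_simp

/-- The angle subtended by the curve at one of its points is an odd multiple of `π`. -/
lemma exp_integral_normalKernel (t : ℝ) :
    Complex.exp ((∫ s in (0 : ℝ)..L, normalKernel c s t : ℝ) * Complex.I) = -1 := by
  have hL := hc.L_pos
  have h1 : Tendsto (fun ε : ℝ => Complex.exp
      ((∫ s in (t + ε)..(t + L - ε), normalKernel c s t : ℝ) * Complex.I)) (𝓝[>] 0)
      (𝓝 (Complex.exp ((∫ s in (0 : ℝ)..L, normalKernel c s t : ℝ) * Complex.I))) := by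
    have : Continuous fun x : ℝ => Complex.exp (x * Complex.I) := by fun_prop
    exact (this.tendsto _).comp (hc.tendsto_integral_normalKernel_left t)
  refine tendsto_nhds_unique h1 ?_
  -- The exponential is the direction of the quotient of the two extreme chords.
  have hq : Tendsto (fun ε : ℝ => ((c (t + ε * (-1)) - c t) / ε) / ((c (t + ε * 1) - c t) / ε))
      (𝓝[>] 0) (𝓝 (-1)) := by
    have h0 := hc.deriv_ne_zero t
    have := (hc.tendsto_scaled_chord t (-1)).div (hc.tendsto_scaled_chord t 1)
      (by simpa using h0)
    have e : (((-1 : ℝ) : ℂ) * deriv c t) / (((1 : ℝ) : ℂ) * deriv c t) = -1 := by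
      push_cast; field_simp
    rwa [e] at this
  have hq' : Tendsto (fun ε : ℝ => (fun q : ℂ => q / ‖q‖)
      (((c (t + ε * (-1)) - c t) / ε) / ((c (t + ε * 1) - c t) / ε))) (𝓝[>] 0)
      (𝓝 ((fun q : ℂ => q / ‖q‖) (-1))) := by
    have hca : ContinuousAt (fun q : ℂ => q / ‖q‖) (-1) := by
      refine continuousAt_id.div ?_ (by simp)
      exact (Complex.continuous_ofReal.comp continuous_norm).continuousAt
    exact hca.tendsto.comp hq
  simp only [norm_neg, norm_one, Complex.ofReal_one, div_one] at hq'
  refine hq'.congr' ?_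
  have : ∀ᶠ ε : ℝ in 𝓝[>] 0, ε < L / 2 := nhdsWithin_le_nhds (Iio_mem_nhds (half_pos hL))
  filter_upwards [this, self_mem_nhdsWithin] with ε hεL (hε : 0 < ε)
  have hexp := hc.exp_integral_logDeriv_chord (t := t) hε hεL
  set J := ∫ s in (t + ε)..(t + L - ε), deriv c s / (c s - c t) with hJ
  rw [hc.integral_normalKernel_eq_im (uIcc_add_sub_subset_Ioo hε hεL), ← hJ]
  have e1 : c (t + ε * (-1)) = c (t + L - ε) := by
    rw [← hc.periodic (t + ε * (-1))]; congr 1; ring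
  have hε' : (ε : ℂ) ≠ 0 := by exact_mod_cast hε.ne'
  have e2 : ((c (t + ε * (-1)) - c t) / ε) / ((c (t + ε * 1) - c t) / ε) = Complex.exp J := by
    rw [div_div_div_cancel_right₀ hε', e1, mul_one, hexp]
  rw [e2, Complex.norm_exp, Complex.ofReal_exp, ← Complex.exp_sub]
  congr 1
  apply Complex.ext <;> simp

/-- At a point of the curve where the real part is maximal and the tangent points upwards, the
curve subtends the angle `π`. -/
lemma integral_normalKernel_of_isMax {t : ℝ} (hmax : ∀ s, (c s).re ≤ (c t).re)
    (hdir : deriv c t = Complex.I) : ∫ s in (0 : ℝ)..L, normalKernel c s t = Real.pi := by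
  have hL := hc.L_pos
  -- The reversed chords lie in the right half plane, where the principal logarithm is smooth.
  have hslit : ∀ s ∈ Ioo t (t + L), -(c s - c t) ∈ Complex.slitPlane := fun s hs => by
    have h0 := hc.sub_ne_zero_of_mem_Ioo hs
    have h1 := hmax s
    rw [Complex.mem_slitPlane_iff]
    by_contra! h
    simp only [Complex.neg_re, Complex.sub_re, Complex.neg_im, Complex.sub_im] at h
    refine h0 (Complex.ext ?_ ?_)
    · simp only [Complex.sub_re, Complex.zero_re]; linarith [h.1]
    · simp only [Complex.sub_im, Complex.zero_im]; linarith [h.2]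
  have hend : Tendsto (fun ε : ℝ => Complex.arg (-((c (t + ε * (-1)) - c t) / ε))
      - Complex.arg (-((c (t + ε * 1) - c t) / ε))) (𝓝[>] 0)
      (𝓝 (Real.pi / 2 - -(Real.pi / 2))) := by
    have h1 := (hc.tendsto_scaled_chord t (-1)).neg
    have h2 := (hc.tendsto_scaled_chord t 1).neg
    simp only [hdir, Complex.ofReal_neg, Complex.ofReal_one, neg_mul, one_mul, neg_neg] at h1 h2
    have ha1 : ContinuousAt Complex.arg Complex.I :=
      Complex.continuousAt_arg (by simp [Complex.mem_slitPlane_iff])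
    have ha2 : ContinuousAt Complex.arg (-Complex.I) :=
      Complex.continuousAt_arg (by simp [Complex.mem_slitPlane_iff])
    have := (ha1.tendsto.comp h1).sub (ha2.tendsto.comp h2)
    rwa [Complex.arg_I, Complex.arg_neg_I] at this
  rw [show Real.pi / 2 - -(Real.pi / 2) = Real.pi by ring] at hend
  refine tendsto_nhds_unique (hc.tendsto_integral_normalKernel_left t) (hend.congr' ?_)
  have : ∀ᶠ ε : ℝ in 𝓝[>] 0, ε < L / 2 := nhdsWithin_le_nhds (Iio_mem_nhds (half_pos hL))
  filter_upwards [this, self_mem_nhdsWithin] with ε hεL (hε : 0 < ε)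
  have hsub := uIcc_add_sub_subset_Ioo (t := t) hε hεL
  rw [hc.integral_normalKernel_eq_im hsub]
  have hFTC := intervalIntegral.integral_eq_sub_of_hasDerivAt
    (f := fun s => Complex.log (-(c s - c t))) (f' := fun s => deriv c s / (c s - c t))
    (a := t + ε) (b := t + L - ε) (fun s hs => by
      have h1 := (((hc.hasDerivAt s).sub_const (c t)).fun_neg).clog_real (hslit s (hsub hs))
      rwa [neg_div_neg_eq] at h1)
    ((hc.continuousOn_logDeriv_chord t).mono hsub).intervalIntegrable
  rw [hFTC, Complex.sub_im, Complex.log_im, Complex.log_im]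
  have e1 : c (t + ε * (-1)) = c (t + L - ε) := by
    rw [← hc.periodic (t + ε * (-1))]; congr 1; ring
  have harg : ∀ z : ℂ, Complex.arg (-(z / ε)) = Complex.arg (-z) := fun z => by
    rw [← neg_div, div_eq_inv_mul, ← Complex.ofReal_inv, Complex.arg_real_mul _ (inv_pos.mpr hε)]
  rw [harg, harg, e1, mul_one]

end IsArcCurve

namespace IsArcDomain

variable {D : Set ℂ} {c : ℝ → ℂ} {L : ℝ} (hD : IsArcDomain D c L)
include hD

/-- At a rightmost boundary point the tangent points upwards, because the domain is on its left. -/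
lemma exists_isMax_re : ∃ t, (∀ s, (c s).re ≤ (c t).re) ∧ deriv c t = Complex.I := by
  have hc := hD.toIsArcCurve
  obtain ⟨_, ⟨t, rfl⟩, hmax⟩ := hc.isCompact_range.exists_isMaxOn ⟨c 0, 0, rfl⟩
    Complex.continuous_re.continuousOn
  have hmax' : ∀ s, (c s).re ≤ (c t).re := fun s => hmax ⟨s, rfl⟩
  refine ⟨t, hmax', ?_⟩
  have hre : (deriv c t).re = 0 := by
    have h1 : HasDerivAt (fun s => (c s).re) (deriv c t).re t := by
      simpa [Function.comp_def] using Complex.reCLM.hasFDerivAt.comp_hasDerivAt t (hc.hasDerivAt t)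
    exact (IsLocalMax.hasDerivAt_eq_zero (Eventually.of_forall hmax') h1)
  have him : (deriv c t).im ^ 2 = 1 := by
    have h2 := Complex.normSq_eq_norm_sq (deriv c t)
    rw [hc.norm_deriv, Complex.normSq_apply, hre] at h2
    linarith
  have hall : ∀ z ∈ closure D, z.re ≤ (c t).re := by
    obtain ⟨y, hy, hymax⟩ := hD.isCompact_closure.exists_isMaxOn hD.isConnected.nonempty.closure
      Complex.continuous_re.continuousOn
    have hyf : y ∈ frontier D := by
      rw [hD.isOpen.frontier_eq]
      refine ⟨hy, fun hyD => ?_⟩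
      have hcont : Tendsto (fun ε : ℝ => y + ε) (𝓝[>] 0) (𝓝 y) := by
        have : Continuous fun ε : ℝ => y + ε := by fun_prop
        simpa using (this.tendsto 0).mono_left (nhdsWithin_le_nhds (s := Ioi 0))
      obtain ⟨ε, hε1, hε2⟩ := ((hcont.eventually_mem (hD.isOpen.mem_nhds hyD)).and
        self_mem_nhdsWithin).exists
      have h3 : (y + ε).re ≤ y.re := hymax (subset_closure hε1)
      have hε2' : 0 < ε := hε2
      simp at h3
      linarith
    rw [hD.frontier_eq] at hyf
    obtain ⟨s, rfl⟩ := hyf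
    exact fun z hz => le_trans (hymax hz) (hmax' s)
  rcases eq_or_eq_neg_of_sq_eq_sq _ 1 (him.trans (one_pow 2).symm) with h | h
  · exact Complex.ext (by simp [hre]) (by simp [h])
  -- If the tangent pointed downwards, the domain would extend beyond its rightmost boundary point.
  · exfalso
    obtain ⟨ε, hε1, hε2⟩ := ((hD.inner_side t).and self_mem_nhdsWithin).exists
    have h3 := hall _ (subset_closure hε1)
    have hε2' : 0 < ε := hε2
    simp [h, hre] at h3
    linarith

/-- Gauss' formula: the domain subtends the angle `π` at each boundary point. -/
theorem integral_normalKernel_left (t : ℝ) :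
    ∫ s in (0 : ℝ)..L, normalKernel c s t = Real.pi := by
  have hc := hD.toIsArcCurve
  have hint : ∀ t, ∃ k : ℤ,
      (∫ s in (0 : ℝ)..L, normalKernel c s t) = Real.pi + k * (2 * Real.pi) := by
    intro t
    have h1 := hc.exp_integral_normalKernel t
    rw [← Complex.exp_pi_mul_I, Complex.exp_eq_exp_iff_exists_int] at h1
    obtain ⟨k, hk⟩ := h1
    refine ⟨k, ?_⟩
    have := congrArg Complex.im hk
    simpa using this
  choose k hk using hint
  have hcont : Continuous k := by
    rw [Int.isClosedEmbedding_coe_real.isInducing.continuous_iff]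
    have : ((↑) : ℤ → ℝ) ∘ k
        = fun t => ((∫ s in (0 : ℝ)..L, normalKernel c s t) - Real.pi) / (2 * Real.pi) := by
      ext t
      simp only [Function.comp]
      rw [hk t]
      field_simp
      ring
    rw [this]
    exact (hc.continuous_integral_normalKernel_left.sub continuous_const).div_const _
  obtain ⟨t₀, hmax, hdir⟩ := hD.exists_isMax_re
  have h0 := hc.integral_normalKernel_of_isMax hmax hdir
  rw [← h0, hk t, hk t₀, PreconnectedSpace.constant inferInstance hcont (x := t) (y := t₀)]

end IsArcDomain

/-! ### Existence of a null density by the Fredholm alternative -/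

namespace IsArcCurve

variable {c : ℝ → ℂ} {L : ℝ} (hc : IsArcCurve c L)

include hc in
lemma continuous_integral_normalKernel_mul {ρ : ℝ → ℝ} (hρ : IntervalIntegrable ρ volume 0 L) :
    Continuous fun s => ∫ t in (0 : ℝ)..L, normalKernel c s t * ρ t := by
  obtain ⟨C, hC, hN⟩ := hc.exists_normalKernel_le
  rw [continuous_iff_continuousAt]
  intro s
  refine intervalIntegral.continuousAt_of_dominated_interval (bound := fun t => C * |ρ t|) ?_ ?_
    (hρ.abs.const_mul C) ?_
  · rw [intervalIntegrable_iff] at hρ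
    exact Eventually.of_forall fun s =>
      (hc.measurable_normalKernel s).aestronglyMeasurable.mul hρ.aestronglyMeasurable
  · refine Eventually.of_forall fun s => Eventually.of_forall fun t _ => ?_
    rw [norm_mul]
    exact mul_le_mul_of_nonneg_right (hN s t) (abs_nonneg _)
  · filter_upwards [hc.ae_ne s] with t ht _
    exact (hc.continuousAt_normalKernel_left (Ne.symm ht)).mul continuousAt_const

include hc in
lemma periodic_integral_normalKernel_mul (ρ : ℝ → ℝ) :
    Function.Periodic (fun s => ∫ t in (0 : ℝ)..L, normalKernel c s t * ρ t) L := fun s => by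
  simp only [normalKernel, hc.periodic s, hc.deriv_periodic s]

include hc in
/-- The normal kernel depends continuously on its first variable in `L¹` of the second one. -/
lemma tendsto_integral_abs_normalKernel_sub (s₀ : ℝ) :
    Tendsto (fun s => ∫ t in (0 : ℝ)..L, |normalKernel c s₀ t - normalKernel c s t|) (𝓝 s₀)
      (𝓝 0) := by
  obtain ⟨C, hC, hN⟩ := hc.exists_normalKernel_le
  have : ContinuousAt
      (fun s => ∫ t in (0 : ℝ)..L, |normalKernel c s₀ t - normalKernel c s t|) s₀ := by
    refine intervalIntegral.continuousAt_of_dominated_interval (bound := fun _ => C + C) ?_ ?_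
      intervalIntegrable_const ?_
    · exact Eventually.of_forall fun s =>
        ((hc.measurable_normalKernel s₀).sub
          (hc.measurable_normalKernel s)).abs.aestronglyMeasurable
    · refine Eventually.of_forall fun s => Eventually.of_forall fun t _ => ?_
      rw [Real.norm_eq_abs, abs_abs]
      exact (abs_sub _ _).trans (add_le_add (hN _ _) (hN _ _))
    · filter_upwards [hc.ae_ne s₀] with t ht _
      exact (continuousAt_const.sub (hc.continuousAt_normalKernel_left (Ne.symm ht))).abs
  simpa [ContinuousAt] using this

/-- The integral operator with kernel `normalKernel`, on bounded continuous functions on the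
parameter interval `[0, L]`. -/
noncomputable def normalOperator (hc : IsArcCurve c L) :
    (Icc (0 : ℝ) L →ᵇ ℝ) →ₗ[ℝ] (Icc (0 : ℝ) L →ᵇ ℝ) where
  toFun ρ := BoundedContinuousFunction.mkOfCompact
    ⟨fun s => ∫ t in (0 : ℝ)..L, normalKernel c s t * IccExtend hc.L_pos.le ρ t,
      (hc.continuous_integral_normalKernel_mul
        (ρ.continuous.Icc_extend'.intervalIntegrable 0 L)).comp continuous_subtype_val⟩
  map_add' ρ₁ ρ₂ := by
    ext s
    simp only [BoundedContinuousFunction.mkOfCompact_apply, ContinuousMap.coe_mk,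
      BoundedContinuousFunction.coe_add, Pi.add_apply]
    rw [← intervalIntegral.integral_add
      (hc.intervalIntegrable_normalKernel_mul s (ρ₁.continuous.Icc_extend'.intervalIntegrable 0 L))
      (hc.intervalIntegrable_normalKernel_mul s (ρ₂.continuous.Icc_extend'.intervalIntegrable 0 L))]
    refine intervalIntegral.integral_congr fun t _ => ?_
    simp only [IccExtend, Function.comp, Pi.add_apply, mul_add]
  map_smul' a ρ := by
    ext s
    simp only [BoundedContinuousFunction.mkOfCompact_apply, ContinuousMap.coe_mk,
      BoundedContinuousFunction.coe_smul, RingHom.id_apply, smul_eq_mul]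
    rw [← intervalIntegral.integral_const_mul]
    refine intervalIntegral.integral_congr fun t _ => ?_
    simp only [IccExtend, Function.comp]
    ring

lemma normalOperator_apply (ρ : Icc (0 : ℝ) L →ᵇ ℝ) (s : Icc (0 : ℝ) L) :
    hc.normalOperator ρ s
      = ∫ t in (0 : ℝ)..L, normalKernel c s t * IccExtend hc.L_pos.le ρ t := rfl

lemma abs_IccExtend_le (ρ : Icc (0 : ℝ) L →ᵇ ℝ) (t : ℝ) :
    |IccExtend hc.L_pos.le ρ t| ≤ ‖ρ‖ := ρ.norm_coe_le_norm _

lemma exists_normalOperator_bound : ∃ C, ∀ ρ, ‖hc.normalOperator ρ‖ ≤ C * ‖ρ‖ := by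
  obtain ⟨C, hC, hN⟩ := hc.exists_normalKernel_le
  have hL := hc.L_pos
  refine ⟨C * L, fun ρ => ?_⟩
  rw [BoundedContinuousFunction.norm_le (by positivity)]
  intro s
  rw [hc.normalOperator_apply]
  have : ∀ t ∈ uIoc 0 L, ‖normalKernel c s t * IccExtend hc.L_pos.le ρ t‖ ≤ C * ‖ρ‖ := fun t _ => by
    rw [norm_mul]
    exact mul_le_mul (hN s t) (hc.abs_IccExtend_le ρ t) (norm_nonneg _) hC.le
  refine (intervalIntegral.norm_integral_le_of_norm_le_const this).trans (le_of_eq ?_)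
  rw [sub_zero, abs_of_pos hL]; ring

/-- Compactness follows from the Arzelà–Ascoli theorem. -/
lemma isCompactOperator_normalOperator : IsCompactOperator hc.normalOperator := by
  obtain ⟨C, hC⟩ := hc.exists_normalOperator_bound
  rw [isCompactOperator_iff_exists_mem_nhds_isCompact_closure_image]
  refine ⟨Metric.closedBall 0 1, Metric.closedBall_mem_nhds _ one_pos, ?_⟩
  refine BoundedContinuousFunction.arzela_ascoli (Metric.closedBall 0 |C|)
    (isCompact_closedBall _ _) _ ?_ ?_
  · rintro _ s ⟨ρ, hρ, rfl⟩
    rw [mem_closedBall_zero_iff] at hρ ⊢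
    calc ‖hc.normalOperator ρ s‖ ≤ ‖hc.normalOperator ρ‖ :=
          BoundedContinuousFunction.norm_coe_le_norm _ _
      _ ≤ C * ‖ρ‖ := hC ρ
      _ ≤ |C| * 1 := by gcongr; exact le_abs_self C
      _ = |C| := mul_one _
  · intro s₀
    refine Metric.equicontinuousAt_of_continuity_modulus
      (fun s : Icc (0 : ℝ) L => ∫ t in (0 : ℝ)..L, |normalKernel c s₀ t - normalKernel c s t|)
      ((hc.tendsto_integral_abs_normalKernel_sub s₀).comp
        (continuous_subtype_val.tendsto s₀)) _ (Eventually.of_forall ?_)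
    rintro s ⟨_, ρ, hρ, rfl⟩
    rw [mem_closedBall_zero_iff] at hρ
    have hi : ∀ s, IntervalIntegrable (fun t => normalKernel c s t * IccExtend hc.L_pos.le ρ t)
        volume 0 L := fun s =>
      hc.intervalIntegrable_normalKernel_mul s (ρ.continuous.Icc_extend'.intervalIntegrable 0 L)
    have hN : ∀ s, IntervalIntegrable (fun t => normalKernel c s t) volume 0 L := fun s => by
      simpa using hc.intervalIntegrable_normalKernel_mul s (ρ := fun _ => 1)
        intervalIntegrable_const
    change dist (hc.normalOperator ρ s₀) (hc.normalOperator ρ s) ≤ _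
    rw [dist_eq_norm, hc.normalOperator_apply, hc.normalOperator_apply,
      ← intervalIntegral.integral_sub (hi s₀) (hi s)]
    refine intervalIntegral.norm_integral_le_of_norm_le hc.L_pos.le
      (Eventually.of_forall fun t _ => ?_) ((hN s₀).sub (hN s)).abs
    rw [← sub_mul, norm_mul]
    refine mul_le_of_le_one_right (abs_nonneg _) ?_
    exact (hc.abs_IccExtend_le ρ t).trans hρ

end IsArcCurve

namespace IsArcDomain

variable {D : Set ℂ} {c : ℝ → ℂ} {L : ℝ} (hD : IsArcDomain D c L)
include hD

/-- By Gauss' formula, constants are in the kernel of the adjoint of `π - normalOperator`. -/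
lemma integral_integral_normalKernel_mul {ρ : ℝ → ℝ} (hρ : Continuous ρ) :
    ∫ s in (0 : ℝ)..L, ∫ t in (0 : ℝ)..L, normalKernel c s t * ρ t
      = Real.pi * ∫ t in (0 : ℝ)..L, ρ t := by
  have hc := hD.toIsArcCurve
  have hL := hc.L_pos
  obtain ⟨C, hC, hN⟩ := hc.exists_normalKernel_le
  have hswap : ∫ s in (0 : ℝ)..L, ∫ t in (0 : ℝ)..L, normalKernel c s t * ρ t
      = ∫ t in (0 : ℝ)..L, ∫ s in (0 : ℝ)..L, normalKernel c s t * ρ t := by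
    simp only [intervalIntegral.integral_of_le hL.le]
    refine integral_integral_swap ?_
    have h1 : Integrable (fun p : ℝ × ℝ => ρ p.2)
        ((volume.restrict (Ioc 0 L)).prod (volume.restrict (Ioc 0 L))) := by
      have : Integrable ρ (volume.restrict (Ioc 0 L)) :=
        (intervalIntegrable_iff_integrableOn_Ioc_of_le hL.le).mp (hρ.intervalIntegrable 0 L)
      exact this.comp_snd _
    exact h1.bdd_mul hc.measurable_normalKernel_uncurry.aestronglyMeasurable
      (Eventually.of_forall fun p => hN p.1 p.2)
  rw [hswap, ← intervalIntegral.integral_const_mul]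
  refine intervalIntegral.integral_congr fun t _ => ?_
  simp only [intervalIntegral.integral_mul_const, hD.integral_normalKernel_left t]

/-- A nonzero null density exists, by the Fredholm alternative: `π - normalOperator` is not
surjective, because all functions in its range have mean zero. -/
theorem exists_isNullDensity_ne_zero : ∃ ρ, IsNullDensity c L ρ ∧ ρ ≠ 0 := by
  have hc := hD.toIsArcCurve
  have hL := hc.L_pos
  obtain ⟨C, hC⟩ := hc.exists_normalOperator_bound
  let T : (Icc (0 : ℝ) L →ᵇ ℝ) →L[ℝ] (Icc (0 : ℝ) L →ᵇ ℝ) := hc.normalOperator.mkContinuous C hC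
  have hT : IsCompactOperator T := hc.isCompactOperator_normalOperator
  rcases hT.hasEigenvalue_or_mem_resolventSet Real.pi_ne_zero with h | h
  · obtain ⟨ρ, hρ⟩ := h.exists_hasEigenvector
    have hρ0 : ρ ≠ 0 := hρ.2
    have heq : ∀ s, hc.normalOperator ρ s = Real.pi * ρ s := fun s => by
      have := hρ.apply_eq_smul
      exact congrArg (fun g : Icc (0 : ℝ) L →ᵇ ℝ => g s) this
    have hi : IntervalIntegrable (IccExtend hc.L_pos.le ρ) volume 0 L :=
      ρ.continuous.Icc_extend'.intervalIntegrable 0 L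
    -- The equation itself extends the eigenfunction periodically to the real line.
    let ρ' : ℝ → ℝ := fun s =>
      (∫ t in (0 : ℝ)..L, normalKernel c s t * IccExtend hc.L_pos.le ρ t) / Real.pi
    have hρ' : ∀ s : Icc (0 : ℝ) L, ρ' s = ρ s := fun s => by
      have := heq s
      rw [hc.normalOperator_apply] at this
      simp only [ρ']
      rw [this]
      field_simp
    refine ⟨ρ', ⟨(hc.continuous_integral_normalKernel_mul hi).div_const _, fun s => ?_,
      fun s => ?_⟩, fun h0 => hρ0 ?_⟩
    · simp only [ρ', hc.periodic_integral_normalKernel_mul _ s]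
    · have : Real.pi * ρ' s
          = ∫ t in (0 : ℝ)..L, normalKernel c s t * IccExtend hc.L_pos.le ρ t := by
        simp only [ρ']; field_simp
      rw [this]
      refine intervalIntegral.integral_congr fun t ht => ?_
      rw [uIcc_of_le hL.le] at ht
      simp only [IccExtend_of_mem hc.L_pos.le ρ ht, ← hρ' ⟨t, ht⟩]
    · ext s
      rw [← hρ' s, h0]; rfl
  · exfalso
    rw [spectrum.mem_resolventSet_iff] at h
    obtain ⟨S, hS⟩ := h.exists_right_inv
    set ρ := S 1 with hρ
    have hval : ∀ s, Real.pi * ρ s - hc.normalOperator ρ s = 1 := fun s => by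
      have := congrArg (fun A : (Icc (0 : ℝ) L →ᵇ ℝ) →L[ℝ] (Icc (0 : ℝ) L →ᵇ ℝ) => A 1 s) hS
      simpa [Algebra.algebraMap_eq_smul_one, T] using this
    have hcont : Continuous (IccExtend hc.L_pos.le ρ) := ρ.continuous.Icc_extend'
    have h1 : ∫ s in (0 : ℝ)..L, (Real.pi * IccExtend hc.L_pos.le ρ s
        - ∫ t in (0 : ℝ)..L, normalKernel c s t * IccExtend hc.L_pos.le ρ t)
        = ∫ s in (0 : ℝ)..L, (1 : ℝ) := by
      refine intervalIntegral.integral_congr fun s hs => ?_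
      rw [uIcc_of_le hL.le] at hs
      have := hval ⟨s, hs⟩
      rw [hc.normalOperator_apply] at this
      simp only [IccExtend_of_mem hc.L_pos.le ρ hs]
      exact this
    have hcπ : Continuous fun s => Real.pi * IccExtend hc.L_pos.le ρ s :=
      continuous_const.mul hcont
    rw [intervalIntegral.integral_sub (hcπ.intervalIntegrable 0 L)
      ((hc.continuous_integral_normalKernel_mul
        (hcont.intervalIntegrable 0 L)).intervalIntegrable 0 L),
      hD.integral_integral_normalKernel_mul hcont, intervalIntegral.integral_const_mul,
      sub_self, intervalIntegral.integral_const] at h1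
    simp at h1
    exact hL.ne h1

end IsArcDomain

/-! ### Transfer to the Euclidean plane -/

/-- The identification of the Euclidean plane with the complex numbers. -/
noncomputable def planeToComplex : Plane ≃ₗᵢ[ℝ] ℂ := Complex.orthonormalBasisOneI.repr.symm

lemma planeToComplex_apply (v : Plane) : planeToComplex v = v 0 + v 1 * Complex.I := by
  rw [planeToComplex, ← OrthonormalBasis.sum_repr_symm]
  simp [Complex.coe_orthonormalBasisOneI]

lemma planeToComplex_rotCW (v : Plane) :
    planeToComplex (rotCW v) = -Complex.I * planeToComplex v := by
  rw [planeToComplex_apply, planeToComplex_apply]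
  simp only [rotCW]
  apply Complex.ext <;> simp

/-- The directional derivative of Green's function, in complex notation. -/
lemma lineDeriv_greenLaplace {x y : Plane} (h : x ≠ y) (v : Plane) :
    lineDeriv ℝ (fun z => greenLaplace z y) x v
      = -(1 / (2 * Real.pi)) * (planeToComplex v / (planeToComplex x - planeToComplex y)).re := by
  have hne : x - y ≠ 0 := sub_ne_zero.mpr h
  have h1 : HasDerivAt (fun t : ℝ => x + t • v - y) v 0 := by
    simpa using (((hasDerivAt_id (0 : ℝ)).smul_const v).const_add x).sub_const y
  have h2 := h1.norm_sq
  simp only [zero_smul, add_zero] at h2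
  have h3 := (h2.log (by simpa using hne)).const_mul (-(1 / (2 * Real.pi)) * (1 / 2))
  have hfun : (fun t : ℝ => greenLaplace (x + t • v) y)
      = fun t : ℝ => -(1 / (2 * Real.pi)) * (1 / 2) * Real.log (‖x + t • v - y‖ ^ 2) := by
    ext t
    rw [greenLaplace, Real.log_pow]
    push_cast; ring
  rw [lineDeriv, hfun, h3.deriv, ← map_sub]
  simp only [zero_smul, add_zero]
  have hin : inner ℝ (x - y) v
      = (planeToComplex v / planeToComplex (x - y)).re * ‖x - y‖ ^ 2 := by
    rw [← planeToComplex.inner_map_map, Complex.inner, ← planeToComplex.norm_map (x - y),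
      ← Complex.normSq_eq_norm_sq, ← Complex.re_mul_ofReal]
    congr 1
    have hne' : planeToComplex (x - y) ≠ 0 :=
      (map_ne_zero_iff _ planeToComplex.injective).mpr hne
    rw [← Complex.mul_conj]
    field_simp
  have hn : ‖x - y‖ ^ 2 ≠ 0 := by simpa using hne
  rw [hin]
  field_simp

namespace SmoothJordanDomain

variable (Ω : SmoothJordanDomain)

/-- The boundary curve in the complex plane. -/
noncomputable def complexCurve (s : ℝ) : ℂ := planeToComplex (Ω.γ s)

lemma hasDerivAt_γ (s : ℝ) : HasDerivAt Ω.γ (deriv Ω.γ s) s :=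
  (Ω.contDiff_γ.differentiable (by simp) s).hasDerivAt

lemma hasDerivAt_complexCurve (s : ℝ) :
    HasDerivAt Ω.complexCurve (planeToComplex (deriv Ω.γ s)) s :=
  (planeToComplex.toContinuousLinearEquiv : Plane →L[ℝ] ℂ).hasFDerivAt.comp_hasDerivAt s
    (Ω.hasDerivAt_γ s)

lemma deriv_complexCurve (s : ℝ) : deriv Ω.complexCurve s = planeToComplex (deriv Ω.γ s) :=
  (Ω.hasDerivAt_complexCurve s).deriv

/-- In complex notation, `Ω` is a domain bounded by an arc length curve with `Ω` on its left. -/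
theorem isArcDomain : IsArcDomain (planeToComplex '' Ω.D) Ω.complexCurve Ω.L where
  L_pos := Ω.L_pos
  contDiff := planeToComplex.toContinuousLinearEquiv.contDiff.comp Ω.contDiff_γ
  periodic s := by simp only [complexCurve, Ω.periodic_γ s]
  injOn s hs t ht h := Ω.injOn_γ hs ht (planeToComplex.injective h)
  norm_deriv s := by rw [deriv_complexCurve, planeToComplex.norm_map, Ω.norm_deriv_γ]
  isOpen := planeToComplex.toHomeomorph.isOpenMap _ Ω.isOpen_D
  isConnected := Ω.isConnected_D.image _ planeToComplex.continuous.continuousOn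
  isBounded := planeToComplex.lipschitz.isBounded_image Ω.isBounded_D
  frontier_eq := by
    have := planeToComplex.toHomeomorph.image_frontier Ω.D
    rw [Ω.frontier_D, ← range_comp] at this
    exact this.symm
  inner_side s := by
    filter_upwards [Ω.inner_side s] with ε hε
    refine ⟨_, hε, ?_⟩
    rw [map_sub, map_smul, planeToComplex_rotCW, deriv_complexCurve, Complex.real_smul]
    rfl

lemma continuous_γ : Continuous Ω.γ := Ω.contDiff_γ.continuous

lemma measurableEmbedding_domRestrict_γ : MeasurableEmbedding ((Ico 0 Ω.L).domRestrict Ω.γ) :=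
  Ω.continuous_γ.continuousOn.measurableEmbedding measurableSet_Ico Ω.injOn_γ

lemma arcLength_eq_map :
    Ω.arcLength = (Measure.comap Subtype.val volume).map ((Ico 0 Ω.L).domRestrict Ω.γ) := by
  rw [arcLength, ← map_comap_subtype_coe measurableSet_Ico,
    Measure.map_map Ω.continuous_γ.measurable measurable_subtype_coe]
  rfl

instance : IsFiniteMeasure Ω.arcLength := by
  unfold arcLength; infer_instance

/-- No measurability is needed to compute integrals against arc length in the parameter, since the
parametrization is a measurable embedding of a period. -/
lemma integral_arcLength (f : Plane → ℝ) :
    ∫ y, f y ∂Ω.arcLength = ∫ t in (0 : ℝ)..Ω.L, f (Ω.γ t) := by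
  rw [arcLength_eq_map, Ω.measurableEmbedding_domRestrict_γ.integral_map,
    intervalIntegral.integral_of_le Ω.L_pos.le, ← restrict_Ico_eq_restrict_Ioc,
    ← integral_subtype_comap measurableSet_Ico]
  rfl

lemma ae_arcLength_iff {P : Plane → Prop} :
    (∀ᵐ x ∂Ω.arcLength, P x) ↔ ∀ᵐ t ∂volume.restrict (Ico 0 Ω.L), P (Ω.γ t) := by
  rw [arcLength_eq_map, Ω.measurableEmbedding_domRestrict_γ.ae_map_iff,
    ae_restrict_iff_subtype measurableSet_Ico]
  rfl

lemma memLp_arcLength_iff {f : Plane → ℝ} :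
    MemLp f 2 Ω.arcLength ↔ MemLp (fun t => f (Ω.γ t)) 2 (volume.restrict (Ico 0 Ω.L)) := by
  rw [arcLength_eq_map, Ω.measurableEmbedding_domRestrict_γ.memLp_map_measure_iff,
    ← map_comap_subtype_coe measurableSet_Ico,
    (MeasurableEmbedding.subtype_coe measurableSet_Ico).memLp_map_measure_iff]
  rfl

lemma tangent_γ {s : ℝ} (hs : s ∈ Ico 0 Ω.L) : Ω.tangent (Ω.γ s) = deriv Ω.γ s := by
  rw [tangent, Ω.injOn_γ.leftInvOn_invFunOn hs]

/-- The truncated integrals in the definition of the principal value, in the arc length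
parameter and in complex notation. -/
lemma integral_truncated_lineDeriv (v : Plane → Plane) (ρ : Plane → ℝ) (s : ℝ) {ε : ℝ}
    (hε : 0 < ε) :
    ∫ y in {y : Plane | ε < ‖Ω.γ s - y‖},
      lineDeriv ℝ (fun z => greenLaplace z y) (Ω.γ s) (v (Ω.γ s)) * ρ y ∂Ω.arcLength
    = -(1 / (2 * Real.pi)) * ∫ t in (0 : ℝ)..Ω.L,
        {t | ε < ‖Ω.complexCurve s - Ω.complexCurve t‖}.indicator
        (fun t => (planeToComplex (v (Ω.γ s)) / (Ω.complexCurve s - Ω.complexCurve t)).re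
          * ρ (Ω.γ t)) t := by
  have hmeas : MeasurableSet {y : Plane | ε < ‖Ω.γ s - y‖} :=
    measurableSet_lt measurable_const (by fun_prop)
  rw [← integral_indicator hmeas, integral_arcLength, ← intervalIntegral.integral_const_mul]
  refine intervalIntegral.integral_congr fun t _ => ?_
  have hn : ‖Ω.complexCurve s - Ω.complexCurve t‖ = ‖Ω.γ s - Ω.γ t‖ := by
    rw [complexCurve, complexCurve, ← map_sub, planeToComplex.norm_map]
  by_cases ht : ε < ‖Ω.γ s - Ω.γ t‖
  · have hne : Ω.γ s ≠ Ω.γ t := sub_ne_zero.mp (norm_pos_iff.mp (hε.trans ht))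
    simp only [indicator, mem_ofPred_eq, hn, if_pos ht]
    rw [lineDeriv_greenLaplace hne, mul_assoc]
    rfl
  · simp only [indicator, mem_ofPred_eq, hn, if_neg ht, mul_zero]

variable {Ω}

lemma _root_.MeasureTheory.MemLp.intervalIntegrable_comp_γ {ρ : Plane → ℝ}
    (hρ : MemLp ρ 2 Ω.arcLength) :
    IntervalIntegrable (fun t => ρ (Ω.γ t)) volume 0 Ω.L := by
  rw [intervalIntegrable_iff_integrableOn_Ioc_of_le Ω.L_pos.le, IntegrableOn,
    ← restrict_Ico_eq_restrict_Ioc]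
  exact (Ω.memLp_arcLength_iff.mp hρ).integrable one_le_two

/-- For `L²` densities the principal value of the normal derivative exists everywhere. -/
lemma hasDerivSL_normal {ρ : Plane → ℝ} (hρ : MemLp ρ 2 Ω.arcLength) {s : ℝ}
    (hs : s ∈ Ico 0 Ω.L) :
    Ω.HasDerivSL Ω.normal ρ (Ω.γ s)
      (-(1 / (2 * Real.pi)) * ∫ t in (0 : ℝ)..Ω.L,
        normalKernel Ω.complexCurve s t * ρ (Ω.γ t)) := by
  have h := (Ω.isArcDomain.tendsto_truncated_normalKernel s
    hρ.intervalIntegrable_comp_γ).const_mul (-(1 / (2 * Real.pi)))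
  refine h.congr' ?_
  filter_upwards [self_mem_nhdsWithin] with ε (hε : 0 < ε)
  rw [Ω.integral_truncated_lineDeriv Ω.normal ρ s hε, normal, Ω.tangent_γ hs,
    planeToComplex_rotCW, ← Ω.deriv_complexCurve]
  congr 1
  refine intervalIntegral.integral_congr fun t _ => ?_
  have hk : ∀ t, (-Complex.I * deriv Ω.complexCurve s
      / (Ω.complexCurve s - Ω.complexCurve t)).re = normalKernel Ω.complexCurve s t := fun t => by
    rw [normalKernel, mul_div_assoc]
    simp
  simp only [hk]

lemma hasDerivSL_normal_iff {ρ : Plane → ℝ} (hρ : MemLp ρ 2 Ω.arcLength) {s : ℝ}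
    (hs : s ∈ Ico 0 Ω.L) :
    (∃ a, Ω.HasDerivSL Ω.normal ρ (Ω.γ s) a ∧ 1 / 2 * ρ (Ω.γ s) + a = 0) ↔
      ∫ t in (0 : ℝ)..Ω.L, normalKernel Ω.complexCurve s t * ρ (Ω.γ t) = Real.pi * ρ (Ω.γ s) := by
  have h := hasDerivSL_normal hρ hs
  have hpi := Real.pi_ne_zero
  set J := ∫ t in (0 : ℝ)..Ω.L, normalKernel Ω.complexCurve s t * ρ (Ω.γ t)
  constructor
  · rintro ⟨a, ha, heq⟩
    rw [tendsto_nhds_unique ha h] at heq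
    field_simp at heq
    linarith
  · intro heq
    refine ⟨_, h, ?_⟩
    rw [heq]
    field_simp
    ring

lemma intervalIntegral_congr_Ico {f g : ℝ → ℝ} (h : f =ᵐ[volume.restrict (Ico 0 Ω.L)] g) (s : ℝ) :
    ∫ t in (0 : ℝ)..Ω.L, normalKernel Ω.complexCurve s t * f t
      = ∫ t in (0 : ℝ)..Ω.L, normalKernel Ω.complexCurve s t * g t := by
  rw [intervalIntegral.integral_of_le Ω.L_pos.le, intervalIntegral.integral_of_le Ω.L_pos.le]
  rw [restrict_Ico_eq_restrict_Ioc] at h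
  refine integral_congr_ae ?_
  filter_upwards [h] with t ht
  rw [ht]

/-- Elements of the `L²` nullspace have continuous representatives, because the normal kernel
regularizes. -/
lemma IsNeumannNull.exists_isNullDensity {ρ : Plane → ℝ} (h : Ω.IsNeumannNull ρ) :
    ∃ R, IsNullDensity Ω.complexCurve Ω.L R ∧
      (fun t => ρ (Ω.γ t)) =ᵐ[volume.restrict (Ico 0 Ω.L)] R := by
  have hc := Ω.isArcDomain.toIsArcCurve
  have hi := h.1.intervalIntegrable_comp_γ
  let R : ℝ → ℝ := fun s =>
    (∫ t in (0 : ℝ)..Ω.L, normalKernel Ω.complexCurve s t * ρ (Ω.γ t)) / Real.pi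
  have hae : (fun t => ρ (Ω.γ t)) =ᵐ[volume.restrict (Ico 0 Ω.L)] R := by
    filter_upwards [Ω.ae_arcLength_iff.mp h.2, ae_restrict_mem measurableSet_Ico] with s h1 hs
    rw [hasDerivSL_normal_iff h.1 hs] at h1
    simp only [R, h1]
    field_simp
  refine ⟨R, ⟨(hc.continuous_integral_normalKernel_mul hi).div_const _, fun s => ?_, fun s => ?_⟩,
    hae⟩
  · simp only [R, hc.periodic_integral_normalKernel_mul (fun t => ρ (Ω.γ t)) s]
  · rw [← intervalIntegral_congr_Ico hae s]
    simp only [R]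
    field_simp

/-- Any function representing a null density lies in the `L²` nullspace. -/
lemma _root_.IsNullDensity.isNeumannNull {R : ℝ → ℝ}
    (hR : IsNullDensity Ω.complexCurve Ω.L R) {ρ : Plane → ℝ}
    (hae : (fun t => ρ (Ω.γ t)) =ᵐ[volume.restrict (Ico 0 Ω.L)] R) : Ω.IsNeumannNull ρ := by
  obtain ⟨M, hM⟩ := (hR.periodic.isBounded_of_continuous Ω.L_pos.ne' hR.continuous).exists_norm_le
  have hmem : MemLp ρ 2 Ω.arcLength := by
    rw [memLp_arcLength_iff]
    refine MemLp.ae_eq hae.symm ?_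
    exact MemLp.of_bound hR.continuous.aestronglyMeasurable M
      (Eventually.of_forall fun t => hM _ ⟨t, rfl⟩)
  refine ⟨hmem, Ω.ae_arcLength_iff.mpr ?_⟩
  filter_upwards [hae, ae_restrict_mem measurableSet_Ico] with s h1 hs
  rw [hasDerivSL_normal_iff hmem hs, intervalIntegral_congr_Ico hae s, hR.integral_eq s, h1]

/-- Two null densities are proportional, since the combination of total mass zero vanishes. -/
lemma _root_.IsNullDensity.exists_eq_mul {R R₁ : ℝ → ℝ}
    (hR : IsNullDensity Ω.complexCurve Ω.L R) (hR0 : R ≠ 0)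
    (hR₁ : IsNullDensity Ω.complexCurve Ω.L R₁) : ∃ a : ℝ, ∀ s, R₁ s = a * R s := by
  have hD := Ω.isArcDomain
  have hm : ∫ t in (0 : ℝ)..Ω.L, R t ≠ 0 := fun h => hR0 (hD.eq_zero_of_integral_eq_zero hR h)
  set a := (∫ t in (0 : ℝ)..Ω.L, R₁ t) / ∫ t in (0 : ℝ)..Ω.L, R t with ha
  have hiR : IntervalIntegrable (fun t => a * R t) volume 0 Ω.L :=
    (hR.continuous.intervalIntegrable 0 Ω.L).const_mul a
  have hdiff : IsNullDensity Ω.complexCurve Ω.L (fun t => R₁ t - a * R t) := by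
    refine ⟨hR₁.continuous.sub (continuous_const.mul hR.continuous), fun t => ?_, fun s => ?_⟩
    · simp only [hR.periodic t, hR₁.periodic t]
    · simp only [mul_sub]
      rw [intervalIntegral.integral_sub
        (hD.intervalIntegrable_normalKernel_mul s (hR₁.continuous.intervalIntegrable 0 Ω.L))
        (hD.intervalIntegrable_normalKernel_mul s hiR)]
      simp only [mul_left_comm _ a]
      rw [intervalIntegral.integral_const_mul, hR.integral_eq s, hR₁.integral_eq s]
  have h0 := hD.eq_zero_of_integral_eq_zero hdiff (by
    rw [intervalIntegral.integral_sub (hR₁.continuous.intervalIntegrable 0 Ω.L) hiR,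
      intervalIntegral.integral_const_mul, ha, div_mul_cancel₀ _ hm, sub_self])
  exact ⟨a, fun s => sub_eq_zero.mp (congrFun h0 s)⟩

variable (Ω)

theorem exists_spansNeumannNullspace : ∃ ρ₀ : Plane → ℝ, Ω.SpansNeumannNullspace ρ₀ := by
  obtain ⟨R, hR, hR0⟩ := Ω.isArcDomain.exists_isNullDensity_ne_zero
  let ρ₀ : Plane → ℝ := fun x => R (Function.invFunOn Ω.γ (Ico 0 Ω.L) x)
  have hρ₀ : ∀ s ∈ Ico 0 Ω.L, ρ₀ (Ω.γ s) = R s := fun s hs => by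
    simp only [ρ₀]
    rw [Ω.injOn_γ.leftInvOn_invFunOn hs]
  have hae : (fun t => ρ₀ (Ω.γ t)) =ᵐ[volume.restrict (Ico 0 Ω.L)] R := by
    filter_upwards [ae_restrict_mem measurableSet_Ico] with s hs using hρ₀ s hs
  refine ⟨ρ₀, fun h => ?_, fun ρ => ⟨fun hρ => ?_, ?_⟩⟩
  · have h1 : R =ᵐ[volume.restrict (Ico 0 Ω.L)] 0 := hae.symm.trans (Ω.ae_arcLength_iff.mp h)
    refine hR0 (Ω.isArcDomain.eq_zero_of_integral_eq_zero hR ?_)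
    rw [intervalIntegral.integral_of_le Ω.L_pos.le, ← restrict_Ico_eq_restrict_Ioc]
    exact integral_eq_zero_of_ae h1
  · obtain ⟨R₁, hR₁, hae₁⟩ := hρ.exists_isNullDensity
    obtain ⟨a, ha⟩ := hR.exists_eq_mul hR0 hR₁
    refine ⟨a, Ω.ae_arcLength_iff.mpr ?_⟩
    filter_upwards [hae, hae₁] with s h1 h2
    rw [h1, h2, ha]
  · rintro ⟨a, ha⟩
    have haR : IsNullDensity Ω.complexCurve Ω.L (fun t => a * R t) := by
      refine ⟨continuous_const.mul hR.continuous, fun t => ?_, fun s => ?_⟩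
      · simp only [hR.periodic t]
      · simp only [mul_left_comm _ a]
        rw [intervalIntegral.integral_const_mul, hR.integral_eq s]
    refine haR.isNeumannNull ?_
    filter_upwards [Ω.ae_arcLength_iff.mp ha, hae] with s h1 h2
    rw [h1, h2]

variable {Ω}

/-- The tangential derivative of the single layer potential of a density in the nullspace
vanishes on the curve. -/
lemma IsNeumannNull.hasDerivSL_tangent {ρ : Plane → ℝ} (h : Ω.IsNeumannNull ρ) :
    ∀ᵐ x ∂Ω.arcLength, Ω.HasDerivSL Ω.tangent ρ x 0 := by
  obtain ⟨R, hR, hae⟩ := h.exists_isNullDensity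
  rw [ae_arcLength_iff]
  filter_upwards [ae_restrict_mem measurableSet_Ico] with s hs
  have h1 := (Ω.isArcDomain.tendsto_tangential hR s).const_mul (-(1 / (2 * Real.pi)))
  rw [mul_zero] at h1
  refine h1.congr' ?_
  filter_upwards [self_mem_nhdsWithin] with ε (hε : 0 < ε)
  rw [Ω.integral_truncated_lineDeriv Ω.tangent ρ s hε, Ω.tangent_γ hs, ← Ω.deriv_complexCurve]
  congr 1
  rw [intervalIntegral.integral_of_le Ω.L_pos.le, intervalIntegral.integral_of_le Ω.L_pos.le]
  rw [restrict_Ico_eq_restrict_Ioc] at hae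
  refine integral_congr_ae ?_
  filter_upwards [hae] with t ht
  simp only [indicator, ht]

lemma HasDerivSL.mul_const {v : Plane → Plane} {ρ : Plane → ℝ} {x : Plane} {a : ℝ}
    (h : Ω.HasDerivSL v ρ x a) (b : ℝ) : Ω.HasDerivSL v (fun y => ρ y * b) x (a * b) := by
  refine (Tendsto.mul_const b h).congr fun ε => ?_
  simp only [← mul_assoc]
  rw [integral_mul_const]

lemma hasDerivSH_zero (v : Plane → Plane) (x : Plane) (t : ℝ) :
    Ω.HasDerivSH v (fun _ _ => 0) x t 0 := by
  simp [HasDerivSH]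

lemma SpansNeumannNullspace.isNeumannNull {ρ₀ : Plane → ℝ} (h : Ω.SpansNeumannNullspace ρ₀) :
    Ω.IsNeumannNull ρ₀ := (h.2 ρ₀).mpr ⟨1, by simp⟩

end SmoothJordanDomain

/-! ### The nullspace of the combined source integral equation -/

theorem lemma4p1 (Ω : SmoothJordanDomain) (T : ℝ) (hT : 0 < T) :
    (∃ ρ₀ : Plane → ℝ, Ω.SpansNeumannNullspace ρ₀) ∧
    ∀ ρ₀ : Plane → ℝ, Ω.SpansNeumannNullspace ρ₀ →
      ∀ f : ℝ → ℝ, ContDiffOn ℝ ∞ f (Icc 0 T) →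
        Ω.InCSIENullspace T (fun x t => ρ₀ x * f t) (fun _ _ => 0) := by
  refine ⟨Ω.exists_spansNeumannNullspace, fun ρ₀ hρ₀ f hf => ?_⟩
  have hnull := hρ₀.isNeumannNull
  have hfc : ContinuousOn f (Icc 0 T) := hf.continuousOn
  refine ⟨?_, MemLp.zero, ?_⟩
  · unfold SmoothJordanDomain.spaceTime
    have hfm : AEStronglyMeasurable f (volume.restrict (Icc 0 T)) :=
      hfc.aestronglyMeasurable measurableSet_Icc
    refine (memLp_two_iff_integrable_sq (hnull.1.1.comp_fst.mul hfm.comp_snd)).mpr ?_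
    simp only [Pi.mul_apply, mul_pow]
    exact hnull.1.integrable_sq.mul_prod ((hfc.pow 2).integrableOn_Icc)
  · have hp := Measure.quasiMeasurePreserving_fst (μ := Ω.arcLength)
      (ν := volume.restrict (Icc 0 T)) |>.ae (hnull.2.and hnull.hasDerivSL_tangent)
    filter_upwards [hp] with p ⟨⟨a, ha, heq⟩, hτ⟩
    refine ⟨a * f p.2, 0, 0, 0, ha.mul_const _, Ω.hasDerivSH_zero _ _ _, Ω.hasDerivSH_zero _ _ _,
      by simpa using hτ.mul_const (f p.2), ?_, ?_⟩
    · rw [inner_zero_right]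
      linear_combination f p.2 * heq
    · simp
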